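/- Let $r\ge 1$ and let $A,R,S$ be real $r\times r$ matrices with $R$ symmetric positive definite, $S$ symmetric positive semi-definite, and $AR=RA'$ (where $'$ denotes transposition), such that the matrices $[R^{1/2},AR^{1/2},\dots,A^{r-1}R^{1/2}]$ and $[S^{1/2},A'S^{1/2},\dots,(A')^{r-1}S^{1/2}]$ have rank $r$. Then the following objects are well defined. * $Q_\infty$, the unique positive definite solution of $A'Q+QA-QRQ+S=0$; put $M:=A-RQ_\infty$. * $(A^2+RS)^{1/2}$, the unique real square root of $A^2+RS$ with positive eigenvalues; $A^2+RS$ itself has only positive eigenvalues. * $P^h_\infty:=\int_0^\infty e^{sM}Re^{sM'}\,ds$, a convergent integral with positive definite value; let $\eta^h_\infty:=\mathcal N(0,P^h_\infty)$ be the centred Gaussian law on $\mathbb R^r$ with covariance $P^h_\infty$, and let $(P^h_\infty)^{1/2}$ be the positive definite square root. * An orthogonal matrix $\mathcal Z=(z_1,\dots,z_r)$ of eigenvectors of $\Lambda^h:=-(P^h_\infty)^{-1/2}(A^2+RS)^{1/2}(P^h_\infty)^{1/2}$, with $\Lambda^h z_i=-\lambda^h_i z_i$ and $\lambda^h_1\le\dots\le\lambda^h_r$.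 Let $\mathcal K^h_t(x,dy):=\mathcal N\big(e^{tM}x,\int_0^t e^{sM}Re^{sM'}ds\big)(dy)$. This is the Markov transition kernel of the $h$-process: if $BB'=R$, $W$ is a standard Brownian motion, and $X^h$ is a solution with continuous paths of $dX^h_t=MX^h_t\,dt+B\,dW_t$, $X^h_0=x$, then $X^h_t$ has law $\mathcal K^h_t(x,\cdot)$ for every $t\ge0$. For every such choice of $\mathcal Z$ and $(\lambda^h_i)$, the $\lambda^h_i$ are positive and are, with multiplicity, the square roots of the eigenvalues of $A^2+RS$. For $n=(n_1,\dots,n_r)\in\mathbb N^r$ put $$\varphi^h_n(x):=\frac1{\sqrt{n!}}\,\mathbb H^r_n\big(\mathcal Z'(P^h_\infty)^{-1/2}x\big),\qquad \lambda^h_n:=\sum_{1\le i\le r}n_i\lambda^h_i,$$ where $n!=\prod_i n_i!$ and $\mathbb H^r_n(x)=\prod_i \mathrm{He}_{n_i}(x_i)$ is the multivariate Chebychev--Hermite polynomial ($\mathrm{He}_k$ is the $k$-th probabilists' Hermite polynomial). Then $(\varphi^h_n)_{n\in\mathbb N^r}$ is an orthonormal basis of $\mathbb L_2(\eta^h_\infty)$,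 and for every $t\ge0$ one has the $\mathbb L_2(\eta^h_\infty)$-spectral decomposition $$\mathcal K^h_t(x,dy)=\sum_{n\in\mathbb N^r}e^{-\lambda^h_nt}\,\varphi^h_n(x)\,\varphi^h_n(y)\,\eta^h_\infty(dy),$$ in the following sense. 1. $\mathcal K^h_t(\varphi^h_n)(x)=e^{-\lambda^h_nt}\varphi^h_n(x)$ for all $n$ and all $x$. 2. For every $f\in\mathbb L_2(\eta^h_\infty)$, the function $f$ is $\mathcal K^h_t(x,\cdot)$-integrable for $\eta^h_\infty$-almost every $x$, and $\mathcal K^h_t(f)=\sum_n e^{-\lambda^h_nt}\,\eta^h_\infty(\varphi^h_nf)\,\varphi^h_n$ with convergence in $\mathbb L_2(\eta^h_\infty)$. 3. If $t>0$, then for every $x$ the measure $\mathcal K^h_t(x,\cdot)$ has a density with respect to $\eta^h_\infty$ which belongs to $\mathbb L_2(\eta^h_\infty)$ and equals $\sum_n e^{-\lambda^h_nt}\varphi^h_n(x)\,\varphi^h_n$, with convergence in $\mathbb L_2(\eta^h_\infty)$. -/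

import Mathlib

open MeasureTheory ProbabilityTheory Matrix
open scoped NNReal ENNReal MatrixOrder

noncomputable section

namespace HDiffusion

/-- The state space `ℝ^r` with its Euclidean structure. -/
abbrev State (r : ℕ) : Type := EuclideanSpace ℝ (Fin r)

/-- The action `x ↦ M x` of a matrix on column vectors. -/
def act {r s : ℕ} (M : Matrix (Fin r) (Fin s) ℝ) (x : State s) : State r :=
  WithLp.toLp 2 (M *ᵥ WithLp.ofLp x)

/-- The block matrix `[C, A C, …, A^(r-1) C]`; its columns are indexed by pairs
(block number, column inside the block). -/
def controllabilityMatrix {r : ℕ} (A C : Matrix (Fin r) (Fin r) ℝ) :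
    Matrix (Fin r) (Fin r × Fin r) ℝ :=
  Matrix.of fun i kj => (A ^ (kj.1 : ℕ) * C) i kj.2

/-- The pair `(A, C)` is controllable: `[C, A C, …, A^(r-1) C]` has rank `r`. -/
def IsControllable {r : ℕ} (A C : Matrix (Fin r) (Fin r) ℝ) : Prop :=
  (controllabilityMatrix A C).rank = r

/-- All the (complex) eigenvalues of the real matrix `M` are positive real numbers: the
characteristic polynomial splits over `ℝ` and its roots are positive. -/
def HasPosEigenvalues {r : ℕ} (M : Matrix (Fin r) (Fin r) ℝ) : Prop :=
  M.charpoly.Splits ∧ ∀ μ ∈ M.charpoly.roots, 0 < μ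

/-- `X` is a square root of `M` all of whose eigenvalues are positive. -/
def IsPosSqrt {r : ℕ} (M X : Matrix (Fin r) (Fin r) ℝ) : Prop :=
  X * X = M ∧ HasPosEigenvalues X

open Classical in
/-- The square root `M^(1/2)` with positive eigenvalues of a matrix which need not be symmetric
(`0` when there is none). -/
def posSqrt {r : ℕ} (M : Matrix (Fin r) (Fin r) ℝ) : Matrix (Fin r) (Fin r) ℝ :=
  if h : ∃ X, IsPosSqrt M X then h.choose else 0

/-- `Q` is a positive definite solution of `A' Q + Q A - Q R Q + S = 0`. -/
def IsRiccatiSolution {r : ℕ} (A R S Q : Matrix (Fin r) (Fin r) ℝ) : Prop :=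
  Q.PosDef ∧ Aᵀ * Q + Q * A - Q * R * Q + S = 0

open Classical in
/-- The matrix `Q_∞`: the positive definite solution of the algebraic Riccati equation
`A' Q + Q A - Q R Q + S = 0` (`0` when there is none). -/
def Qinf {r : ℕ} (A R S : Matrix (Fin r) (Fin r) ℝ) : Matrix (Fin r) (Fin r) ℝ :=
  if h : ∃ Q, IsRiccatiSolution A R S Q then h.choose else 0

/-- The drift matrix `A - R Q_∞` of the `h`-process. -/
def drift {r : ℕ} (A R S : Matrix (Fin r) (Fin r) ℝ) : Matrix (Fin r) (Fin r) ℝ :=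
  A - R * Qinf A R S

/-- The integrand `e^{s M} R e^{s M'}` of the Gramians of the linear diffusion with drift matrix
`M` and diffusion matrix `R`. -/
def gramIntegrand {r : ℕ} (M R : Matrix (Fin r) (Fin r) ℝ) (s : ℝ) :
    Matrix (Fin r) (Fin r) ℝ :=
  NormedSpace.exp (s • M) * R * NormedSpace.exp (s • Mᵀ)

/-- The covariance `∫_0^t e^{s (A - R Q_∞)} R e^{s (A - R Q_∞)'} ds` of the `h`-process at
time `t` started from a point. -/
def hCov {r : ℕ} (A R S : Matrix (Fin r) (Fin r) ℝ) (t : ℝ≥0) : Matrix (Fin r) (Fin r) ℝ :=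
  Matrix.of fun i j => ∫ s in (0 : ℝ)..(t : ℝ), gramIntegrand (drift A R S) R s i j

/-- The limiting covariance
`P^h_∞ = ∫_0^∞ e^{s (A - R Q_∞)} R e^{s (A - R Q_∞)'} ds`. -/
def hCovInf {r : ℕ} (A R S : Matrix (Fin r) (Fin r) ℝ) : Matrix (Fin r) (Fin r) ℝ :=
  Matrix.of fun i j => ∫ s in Set.Ioi (0 : ℝ), gramIntegrand (drift A R S) R s i j

/-- The centred Gaussian measure `η^h_∞ = N(0, P^h_∞)`. -/
def etaInf {r : ℕ} (A R S : Matrix (Fin r) (Fin r) ℝ) : Measure (State r) :=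
  multivariateGaussian 0 (hCovInf A R S)

/-- Gaussian measures with a fixed covariance depend measurably on their mean. -/
lemma measurable_gaussian_mean {r : ℕ} (M C : Matrix (Fin r) (Fin r) ℝ) :
    Measurable fun x : State r => multivariateGaussian (act M x) C := by
  have hact : Measurable fun x : State r => act M x := by
    have : (fun x : State r => act M x) = toEuclideanCLM (𝕜 := ℝ) M := by
      ext x i; rfl
    rw [this]
    fun_prop
  refine Measure.measurable_of_measurable_coe _ fun s hs => ?_
  have hjoint : Measurable fun p : State r × State r =>
      act M p.1 + toEuclideanCLM (𝕜 := ℝ) (CFC.sqrt C) p.2 :=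
    (hact.comp measurable_fst).add (by fun_prop)
  have h := measurable_measure_prodMk_left (ν := stdGaussian (State r)) (hjoint hs)
  convert h using 1
  funext x
  rw [multivariateGaussian, Measure.map_apply (by fun_prop) hs]
  rfl

/-- The Markov transition kernel `K^h_t(x, dy)` of the `h`-process: the Gaussian law with mean
`e^{t (A - R Q_∞)} x` and covariance `hCov A R S t`. -/
def hKernel {r : ℕ} (A R S : Matrix (Fin r) (Fin r) ℝ) (t : ℝ≥0) :
    Kernel (State r) (State r) where
  toFun x := multivariateGaussian (act (NormedSpace.exp ((t : ℝ) • drift A R S)) x)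
    (hCov A R S t)
  measurable' := measurable_gaussian_mean _ _

/-- `W` is a `d`-dimensional standard Brownian motion: its coordinates are independent
one-dimensional Brownian motions. -/
def IsBrownianVector {Ω : Type*} [MeasurableSpace Ω] {d : ℕ}
    (W : Fin d → ℝ≥0 → Ω → ℝ) (P : Measure Ω) : Prop :=
  (∀ j, IsBrownianReal (W j) P) ∧ iIndepFun (fun j ω t => W j t ω) P

/-- `X` has continuous paths and solves `dX_t = M X_t dt + B dW_t` with `X_0 = x`. As the noise is
additive, the equation is the integral equation `X_t = x + ∫_0^t M X_s ds + B W_t`. -/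
def IsLinearDiffusion {Ω : Type*} [MeasurableSpace Ω] {r d : ℕ}
    (M : Matrix (Fin r) (Fin r) ℝ) (B : Matrix (Fin r) (Fin d) ℝ) (x : State r)
    (W : Fin d → ℝ≥0 → Ω → ℝ) (X : ℝ≥0 → Ω → State r) (P : Measure Ω) : Prop :=
  ∀ᵐ ω ∂P, Continuous (fun t => X t ω) ∧
    ∀ t : ℝ≥0, X t ω = x + (∫ s in (0 : ℝ)..(t : ℝ), act M (X s.toNNReal ω))
      + act B (WithLp.toLp 2 fun j => W j t ω)

/-- The matrix `Λ^h = -(P^h_∞)^(-1/2) (A² + R S)^(1/2) (P^h_∞)^(1/2)`. -/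
def LambdaMat {r : ℕ} (A R S : Matrix (Fin r) (Fin r) ℝ) : Matrix (Fin r) (Fin r) ℝ :=
  -((CFC.sqrt (hCovInf A R S))⁻¹ * posSqrt (A ^ 2 + R * S) * CFC.sqrt (hCovInf A R S))

/-- `Z` is an orthogonal matrix whose `i`-th column is an eigenvector of `Λ^h` for the eigenvalue
`-lam i`, and the numbers `lam i` are ranked in increasing order. -/
structure IsEigenData {r : ℕ} (A R S Z : Matrix (Fin r) (Fin r) ℝ) (lam : Fin r → ℝ) : Prop where
  orthogonal : Z ∈ Matrix.orthogonalGroup (Fin r) ℝ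
  eigen : ∀ i, LambdaMat A R S *ᵥ Z.col i = (-lam i) • Z.col i
  ranked : Monotone lam

/-- The multivariate Chebychev–Hermite polynomial
`H_n(x) = ∏ i, He_{n i}(x i)`, that is the coefficient of `u^n / n!` in
`exp(u'x - u'u / 2)`. -/
def hermiteMulti {r : ℕ} (n : Fin r → ℕ) (x : State r) : ℝ :=
  ∏ i, Polynomial.aeval (x i) (Polynomial.hermite (n i))

/-- The functions `φ_n(x) = H_n(Z' (P^h_∞)^(-1/2) x) / √(n!)`, where `n! = ∏ i, (n i)!`. -/
def phi {r : ℕ} (A R S Z : Matrix (Fin r) (Fin r) ℝ) (n : Fin r → ℕ) (x : State r) : ℝ :=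
  hermiteMulti n (act (Zᵀ * (CFC.sqrt (hCovInf A R S))⁻¹) x) /
    √(∏ i, ((n i).factorial : ℝ))

/-- The eigenvalues `lam_n = ∑ i, n_i lam_i`. -/
def eigval {r : ℕ} (lam : Fin r → ℝ) (n : Fin r → ℕ) : ℝ :=
  ∑ i, (n i : ℝ) * lam i

end HDiffusion

end

/-! Put `C = R^(1/2)`. The relation `A R = R A'` says that `Ã = C⁻¹ A C` is symmetric. With `S̃ = C
S C` and `Q̃ = C Q C` the Riccati equation becomes `(Q̃ - Ã)² = Ã² + S̃`, so the candidate is `Q̃ =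
Ã + Y` with `Y = (Ã² + S̃)^(1/2)`. Observability of `(A, S^(1/2))` makes `Y` and `Ã + Y` positive
definite, and conversely a positive definite `Q̃` forces `Q̃ - Ã` to be positive
(`riccati_structure`). The drift is then `M = -C Y C⁻¹`: up to sign it is the square root of `A² + R
S`, and it is diagonalizable over the reals.

Consequently `P = ½ C Y⁻¹ C` and `R = -2 M P`, so `-Λ = ½ P^(-1/2) R P^(-1/2)` is symmetric positive
definite. With `G = P^(1/2) Z` one gets `M = -G diag(λ) G⁻¹`, `R = G diag(2λ) G'` and `P = G G'`
(`eigenData_structure`). In the coordinates `ξ = G⁻¹ x` the law `η` is standard Gaussian and the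
kernel is the product of the laws `N(e^{-λ_i t} ξ_i, 1 - e^{-2 λ_i t})` (`hKernel_eq_map`).

The spectral theory is thus that of one-dimensional Ornstein-Uhlenbeck kernels. Mehler's formula
gives the eigenfunctions, integration by parts their orthogonality, and injectivity of the Fourier
transform their completeness. For `t > 0` the variances lie strictly between 0 and 2, so the kernel
has a square integrable density; its coefficients are read off from Mehler's formula, and pairing
its expansion with `f` gives the expansion of the operator.

The law of the diffusion is found without stochastic integrals: along each path the solution is a
limit of Riemann-Stieltjes sums of Brownian increments, whose characteristic functions are explicit
(`hasLaw_linearDiffusion`). -/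

namespace HDiffusion

/-! ### Hermite polynomials and one-dimensional Gaussian integrals. -/

section Hermite

open Polynomial

/-- The probabilists' Hermite polynomial with real coefficients. -/
noncomputable def hermiteR (n : ℕ) : ℝ[X] := (hermite n).map (Int.castRingHom ℝ)

lemma aeval_hermite_eq (n : ℕ) (x : ℝ) : aeval x (hermite n) = (hermiteR n).eval x := by
  rw [aeval_def, hermiteR, eval_map]; rfl

lemma hermiteR_zero : hermiteR 0 = 1 := by simp [hermiteR]

lemma hermiteR_succ (n : ℕ) : hermiteR (n + 1) = X * hermiteR n - derivative (hermiteR n) := by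
  simp [hermiteR, hermite_succ, derivative_map]

/-- The derivative lowers the index while `X - d/dx` raises it; the two rules together reduce the
Gaussian integrals below to integration by parts. -/
lemma derivative_hermiteR_succ (n : ℕ) :
    derivative (hermiteR (n + 1)) = (n + 1 : ℝ[X]) * hermiteR n := by
  induction n with
  | zero => simp [hermiteR_succ, hermiteR_zero]
  | succ n ih =>
    rw [hermiteR_succ (n + 1), derivative_sub, derivative_mul, derivative_X, ih]
    have : derivative ((n + 1 : ℝ[X]) * hermiteR n) = (n + 1) * derivative (hermiteR n) := by
      rw [derivative_mul]; simp
    rw [this, hermiteR_succ n]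
    push_cast; ring

lemma natDegree_hermiteR (n : ℕ) : (hermiteR n).natDegree = n := by
  rw [hermiteR, (hermite_monic n).natDegree_map, natDegree_hermite]

lemma hermiteR_monic (n : ℕ) : (hermiteR n).Monic := (hermite_monic n).map _

lemma iterate_derivative_hermiteR (n : ℕ) :
    derivative^[n] (hermiteR n) = C (n.factorial : ℝ) := by
  induction n with
  | zero => simp [hermiteR_zero]
  | succ n ih =>
    rw [Function.iterate_succ_apply, derivative_hermiteR_succ]
    have : (n + 1 : ℝ[X]) * hermiteR n = C (n + 1 : ℝ) * hermiteR n := by simp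
    rw [this, iterate_derivative_C_mul, ih, ← C_mul, Nat.factorial_succ]
    push_cast; rfl

/-- Every polynomial of degree at most `n` is a combination of `He_0, …, He_n`. -/
lemma exists_hermite_expansion (n : ℕ) : ∀ p : ℝ[X], p.natDegree ≤ n →
    ∃ c : ℕ → ℝ, p = ∑ k ∈ Finset.range (n + 1), C (c k) * hermiteR k := by
  induction n with
  | zero =>
    intro p hp
    refine ⟨fun _ => p.coeff 0, ?_⟩
    simp [hermiteR_zero, ← eq_C_of_natDegree_le_zero hp]
  | succ n ih =>
    intro p hp
    -- As `He_{n+1}` is monic of degree `n + 1`, this subtraction removes the top coefficient.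
    obtain ⟨c, hc⟩ := ih (p - C (p.coeff (n + 1)) * hermiteR (n + 1)) (by
      rw [natDegree_le_iff_coeff_eq_zero]
      intro N hN
      rw [coeff_sub, coeff_C_mul]
      rcases Nat.lt_or_ge (n + 1) N with h | h
      · rw [coeff_eq_zero_of_natDegree_lt (hp.trans_lt h),
          coeff_eq_zero_of_natDegree_lt ((natDegree_hermiteR _).trans_lt h)]
        simp
      · obtain rfl : N = n + 1 := by omega
        have := (hermiteR_monic (n + 1)).coeff_natDegree
        rw [natDegree_hermiteR] at this
        rw [this]; ring)
    refine ⟨fun k => if k = n + 1 then p.coeff (n + 1) else c k, ?_⟩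
    simp only [Finset.sum_range_succ _ (n + 1), if_true]
    rw [← sub_eq_iff_eq_add, hc]
    refine Finset.sum_congr rfl fun k hk => ?_
    rw [if_neg (by have := Finset.mem_range.1 hk; omega)]

lemma integrable_eval_gaussianReal (p : ℝ[X]) (m : ℝ) (v : ℝ≥0) :
    Integrable (fun x => p.eval x) (gaussianReal m v) := by
  simp_rw [eval_eq_sum_range]
  refine integrable_finsetSum _ fun i _ => Integrable.const_mul ?_ _
  have h := (memLp_id_gaussianReal (μ := m) (v := v) (i : ℝ≥0)).integrable_norm_pow'
  refine Integrable.mono' (g := fun x => ‖x‖ ^ i) ?_ (by fun_prop) (by simp)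
  simpa using h

lemma hasDerivAt_gaussianPDFReal (m : ℝ) {v : ℝ≥0} (hv : v ≠ 0) (x : ℝ) :
    HasDerivAt (gaussianPDFReal m v) (-((x - m) / v) * gaussianPDFReal m v x) x := by
  have hv' : (v : ℝ) ≠ 0 := by exact_mod_cast hv
  have h : HasDerivAt (fun x : ℝ => -(x - m) ^ 2 / (2 * v)) (-((x - m) / v)) x := by
    have := ((((hasDerivAt_id x).sub_const m).pow 2).neg).div_const (2 * (v : ℝ))
    convert! this using 1
    simp; field_simp
  rw [gaussianPDFReal_def]
  convert! h.exp.const_mul (√(2 * Real.pi * v))⁻¹ using 1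
  dsimp only
  ring

/-- Gaussian integration by parts for polynomials. -/
lemma integral_sub_mul_eval_gaussianReal (p : ℝ[X]) (m : ℝ) (v : ℝ≥0) :
    ∫ x, (x - m) * p.eval x ∂gaussianReal m v
      = v * ∫ x, (derivative p).eval x ∂gaussianReal m v := by
  -- For `v = 0` the law is the Dirac mass at `m` and both sides vanish; this case serves the kernel
  -- at time 0.
  by_cases hv : v = 0
  · subst hv; simp
  have hv' : (v : ℝ) ≠ 0 := by exact_mod_cast hv
  have hint : ∀ q : ℝ[X], Integrable fun x => q.eval x * gaussianPDFReal m v x := by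
    intro q
    have h := integrable_eval_gaussianReal q m v
    rw [gaussianReal_of_var_ne_zero m hv, integrable_withDensity_iff (measurable_gaussianPDF m v)
      (ae_of_all _ fun _ => gaussianPDF_lt_top)] at h
    simpa using h
  have key := integral_mul_deriv_eq_deriv_mul_of_integrable (u := fun x => p.eval x)
    (v := gaussianPDFReal m v) (u' := fun x => (derivative p).eval x)
    (v' := fun x => -((x - m) / v) * gaussianPDFReal m v x)
    (fun x _ => p.hasDerivAt x) (fun x _ => hasDerivAt_gaussianPDFReal m hv x)
    (by
      convert! hint (p * (C (-(v : ℝ)⁻¹) * (X - C m))) using 2 with x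
      simp; ring) (hint _) (hint _)
  rw [integral_gaussianReal_eq_integral_smul hv, integral_gaussianReal_eq_integral_smul hv]
  have e1 : ∫ x, p.eval x * (-((x - m) / v) * gaussianPDFReal m v x)
      = -(v : ℝ)⁻¹ * ∫ x, gaussianPDFReal m v x • ((x - m) * p.eval x) := by
    rw [← integral_const_mul]
    congr 1; ext x; simp; ring
  have e2 : ∫ x, (derivative p).eval x * gaussianPDFReal m v x
      = ∫ x, gaussianPDFReal m v x • (derivative p).eval x := by
    congr 1; ext x; simp; ring
  rw [e1, e2] at key
  field_simp at key
  linarith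

lemma integral_id_mul_eval_gaussianReal (p : ℝ[X]) (m : ℝ) (v : ℝ≥0) :
    ∫ x, x * p.eval x ∂gaussianReal m v
      = m * ∫ x, p.eval x ∂gaussianReal m v
        + v * ∫ x, (derivative p).eval x ∂gaussianReal m v := by
  rw [← integral_sub_mul_eval_gaussianReal, ← integral_const_mul, ← integral_add]
  · congr 1; ext x; ring
  · exact (integrable_eval_gaussianReal p m v).const_mul m
  · convert integrable_eval_gaussianReal ((X - C m) * p) m v using 2 with x
    simp

/-- **Mehler's formula** in dimension one: Hermite polynomials are eigenfunctions of the
Ornstein-Uhlenbeck kernels. -/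
lemma integral_hermiteR_gaussianReal (ρ : ℝ) (v : ℝ≥0) (hv : (v : ℝ) = 1 - ρ ^ 2) (x : ℝ) (n : ℕ) :
    ∫ y, (hermiteR n).eval y ∂gaussianReal (ρ * x) v = ρ ^ n * (hermiteR n).eval x := by
  -- In `He_{n+2} = y He_{n+1} - (n+1) He_n`, integration by parts produces `(1 - ρ²)(n+1) ρ^n
  -- He_n(x)`. Subtracting `(n+1) ρ^n He_n(x)` leaves `-ρ^{n+2} (n+1) He_n(x)`, so the recursion
  -- reappears with the factor `ρ^{n+2}`.
  induction n using Nat.twoStepInduction with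
  | zero => simp [hermiteR_zero]
  | one =>
    have := integral_id_mul_eval_gaussianReal 1 (ρ * x) v
    simp at this
    simp [hermiteR_succ, hermiteR_zero]
  | more n ih0 ih1 =>
    have e : ∀ y, (hermiteR (n + 2)).eval y
        = y * (hermiteR (n + 1)).eval y - (derivative (hermiteR (n + 1))).eval y := by
      intro y; rw [hermiteR_succ (n + 1)]; simp
    have e' : ∀ y, (derivative (hermiteR (n + 1))).eval y = (n + 1) * (hermiteR n).eval y := by
      intro y; rw [derivative_hermiteR_succ]; simp
    simp_rw [e]
    rw [integral_sub, integral_id_mul_eval_gaussianReal, hv, ih1]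
    · simp_rw [e']
      rw [integral_const_mul, ih0]
      ring
    · convert integrable_eval_gaussianReal (X * hermiteR (n + 1)) _ v using 2 with x
      simp
    · exact integrable_eval_gaussianReal _ _ _

/-- In `L²(N(0,1))` the raising operator `X - d/dx` is the adjoint of `d/dx`. -/
lemma integral_hermiteR_succ_mul (n : ℕ) (p : ℝ[X]) :
    ∫ x, (hermiteR (n + 1) * p).eval x ∂gaussianReal 0 1
      = ∫ x, (hermiteR n * derivative p).eval x ∂gaussianReal 0 1 := by
  have e : ∀ x, (hermiteR (n + 1) * p).eval x
      = x * (hermiteR n * p).eval x - (derivative (hermiteR n) * p).eval x := by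
    intro x; rw [hermiteR_succ n]; simp; ring
  simp_rw [e]
  rw [integral_sub, integral_id_mul_eval_gaussianReal, derivative_mul]
  · simp_rw [eval_add]
    rw [integral_add (integrable_eval_gaussianReal _ _ _) (integrable_eval_gaussianReal _ _ _)]
    simp
  · convert integrable_eval_gaussianReal (X * (hermiteR n * p)) 0 1 using 2 with x
    simp
  · exact integrable_eval_gaussianReal _ _ _

lemma integral_hermiteR_mul (n : ℕ) : ∀ p : ℝ[X],
    ∫ x, (hermiteR n * p).eval x ∂gaussianReal 0 1
      = ∫ x, (derivative^[n] p).eval x ∂gaussianReal 0 1 := by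
  induction n with
  | zero => intro p; simp [hermiteR_zero]
  | succ n ih => intro p; rw [integral_hermiteR_succ_mul, ih, Function.iterate_succ_apply]

/-- Orthogonality of the Hermite polynomials for the standard Gaussian law. -/
lemma integral_hermiteR_mul_hermiteR (n m : ℕ) :
    ∫ x, (hermiteR n).eval x * (hermiteR m).eval x ∂gaussianReal 0 1
      = if n = m then (n.factorial : ℝ) else 0 := by
  -- With `m ≤ n`, the `n` derivatives are moved onto `He_m`: they kill it if `m < n` and leave `n!`
  -- if `m = n`.
  wlog h : m ≤ n generalizing n m
  · have := this m n (by omega)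
    simp_rw [mul_comm ((hermiteR n).eval _)]
    rw [this]
    split_ifs <;> first | omega | simp_all
  simp_rw [← eval_mul]
  rw [integral_hermiteR_mul]
  split_ifs with hnm
  · subst hnm; simp [iterate_derivative_hermiteR]
  · rw [iterate_derivative_eq_zero (by rw [natDegree_hermiteR]; omega)]; simp

end Hermite

/-! ### Gaussian densities relative to the standard law. -/

/-- The density of `N(m, v)` with respect to `N(0, 1)`. -/
noncomputable def gaussianRatio (m : ℝ) (v : ℝ≥0) (x : ℝ) : ℝ :=
  gaussianPDFReal m v x / gaussianPDFReal 0 1 x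

lemma gaussianRatio_nonneg (m : ℝ) (v : ℝ≥0) (x : ℝ) : 0 ≤ gaussianRatio m v x :=
  div_nonneg (gaussianPDFReal_nonneg _ _ _) (gaussianPDFReal_nonneg _ _ _)

lemma measurable_gaussianRatio (m : ℝ) (v : ℝ≥0) : Measurable (gaussianRatio m v) :=
  (measurable_gaussianPDFReal m v).div (measurable_gaussianPDFReal 0 1)

lemma gaussianReal_eq_withDensity_gaussianRatio (m : ℝ) {v : ℝ≥0} (hv : v ≠ 0) :
    gaussianReal m v
      = (gaussianReal 0 1).withDensity fun x => ENNReal.ofReal (gaussianRatio m v x) := by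
  rw [gaussianReal_of_var_ne_zero m hv, gaussianReal_of_var_ne_zero 0 one_ne_zero,
    ← withDensity_mul _ (measurable_gaussianPDF 0 1) (measurable_gaussianRatio m v).ennreal_ofReal]
  congr 1; ext x
  have h := gaussianPDFReal_pos 0 1 x one_ne_zero
  rw [Pi.mul_apply, gaussianPDF, gaussianPDF, ← ENNReal.ofReal_mul h.le, gaussianRatio,
    mul_div_cancel₀ _ h.ne']

/-- Squaring the ratio and multiplying by the standard density gives a Gaussian exponent with
leading term `-(1/v - 1/2) x²`, which is negative because `v < 2`. -/
lemma integrable_gaussianRatio_sq (m : ℝ) {v : ℝ≥0} (hv : v ≠ 0) (hv2 : v < 2) :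
    Integrable (fun x => gaussianRatio m v x ^ 2) (gaussianReal 0 1) := by
  rw [gaussianReal_of_var_ne_zero 0 one_ne_zero, integrable_withDensity_iff
    (measurable_gaussianPDF 0 1) (ae_of_all _ fun _ => gaussianPDF_lt_top)]
  have hv' : 0 < (v : ℝ) := by positivity
  have hv2' : (v : ℝ) < 2 := by exact_mod_cast hv2
  have hb : 0 < (v : ℝ)⁻¹ - 1 / 2 := by
    rw [sub_pos, one_div]; exact inv_strictAnti₀ hv' hv2'
  have hq := integrable_cexp_quadratic' (b := ((-((v : ℝ)⁻¹ - 1 / 2) : ℝ) : ℂ))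
    (by rw [Complex.ofReal_re]; linarith) ((2 * m / v : ℝ) : ℂ) ((-m ^ 2 / v : ℝ) : ℂ)
  have hq' := hq.norm.const_mul (((√(2 * Real.pi * v))⁻¹) ^ 2 / (√(2 * Real.pi * (1 : ℝ≥0)))⁻¹)
  refine hq'.congr (ae_of_all _ fun x => ?_)
  have hs : √(2 * Real.pi * (1 : ℝ≥0)) ≠ 0 := by positivity
  simp only [gaussianRatio, toReal_gaussianPDF, gaussianPDFReal]
  rw [← Complex.ofReal_pow, ← Complex.ofReal_mul, ← Complex.ofReal_mul, ← Complex.ofReal_add,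
    ← Complex.ofReal_add, ← Complex.ofReal_exp, Complex.norm_real, Real.norm_eq_abs,
    abs_of_pos (Real.exp_pos _)]
  have e : Real.exp (-((v : ℝ)⁻¹ - 1 / 2) * x ^ 2 + 2 * m / v * x + -m ^ 2 / v)
      = Real.exp (-(x - m) ^ 2 / (2 * v)) ^ 2 / Real.exp (-(x - 0) ^ 2 / (2 * (1 : ℝ≥0))) := by
    rw [← Real.exp_nat_mul, ← Real.exp_sub]
    congr 1
    push_cast
    field_simp
    ring
  rw [e]
  have := Real.exp_pos (-(x - 0) ^ 2 / (2 * (1 : ℝ≥0)))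
  field_simp

end HDiffusion

namespace HDiffusion

/-! ### Products of one-dimensional laws and of Hermite polynomials. -/

section Product

variable {ι : Type*} [Fintype ι]

/-- Product measures are determined by boxes, on which the integral of the product density factors.
-/
lemma pi_eq_withDensity_prod {μ ν : ι → Measure ℝ} [∀ i, IsProbabilityMeasure (μ i)]
    [∀ i, IsProbabilityMeasure (ν i)] {d : ι → ℝ → ℝ} (hd : ∀ i x, 0 ≤ d i x)
    (hint : ∀ i, Integrable (d i) (μ i))
    (h : ∀ i, ν i = (μ i).withDensity fun x => ENNReal.ofReal (d i x)) :
    Measure.pi ν = (Measure.pi μ).withDensity fun x => ENNReal.ofReal (∏ i, d i (x i)) := by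
  refine Measure.pi_eq (μ := ν) fun s hs => ?_
  rw [withDensity_apply _ (MeasurableSet.univ_pi hs), Measure.restrict_pi_pi,
    ← ofReal_integral_eq_lintegral_ofReal
      (Integrable.fintype_prod (f := d) (μ := fun i => (μ i).restrict (s i))
        fun i => (hint i).restrict)
      (ae_of_all _ fun x => Finset.prod_nonneg fun i _ => hd i (x i)),
    integral_fintype_prod_eq_prod (f := d),
    ENNReal.ofReal_prod_of_nonneg fun i _ => integral_nonneg (hd i)]
  refine Finset.prod_congr rfl fun i _ => ?_
  rw [ofReal_integral_eq_lintegral_ofReal (hint i).restrict (ae_of_all _ (hd i)), h i,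
    withDensity_apply _ (hs i)]

lemma memLp_two_prod {μ : ι → Measure ℝ} [∀ i, IsProbabilityMeasure (μ i)] {f : ι → ℝ → ℝ}
    (hf : ∀ i, Measurable (f i)) (hint : ∀ i, Integrable (fun x => f i x ^ 2) (μ i)) :
    MemLp (fun x : ι → ℝ => ∏ i, f i (x i)) 2 (Measure.pi μ) := by
  rw [memLp_two_iff_integrable_sq (Measurable.aestronglyMeasurable (by fun_prop))]
  simp_rw [← Finset.prod_pow]
  exact Integrable.fintype_prod (f := fun i x => f i x ^ 2) hint

/-- The standard Gaussian law on `ι → ℝ`. -/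
noncomputable abbrev stdPi (ι : Type*) [Fintype ι] : Measure (ι → ℝ) :=
  Measure.pi fun _ : ι => gaussianReal 0 1

/-- Products of Hermite polynomials. -/
noncomputable def hermiteProd (n : ι → ℕ) (x : ι → ℝ) : ℝ := ∏ i, (hermiteR (n i)).eval (x i)

lemma memLp_hermiteProd (n : ι → ℕ) : MemLp (hermiteProd n) 2 (stdPi ι) := by
  refine memLp_two_prod (f := fun i x => (hermiteR (n i)).eval x) (fun i => by fun_prop) fun i => ?_
  simp_rw [← Polynomial.eval_pow]
  exact integrable_eval_gaussianReal _ _ _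

lemma integral_hermiteProd_mul_hermiteProd [DecidableEq ι] (n m : ι → ℕ) :
    ∫ x, hermiteProd n x * hermiteProd m x ∂stdPi ι
      = if n = m then ∏ i, ((n i).factorial : ℝ) else 0 := by
  simp_rw [hermiteProd, ← Finset.prod_mul_distrib]
  rw [integral_fintype_prod_eq_prod
    (f := fun i x => (hermiteR (n i)).eval x * (hermiteR (m i)).eval x)]
  simp_rw [integral_hermiteR_mul_hermiteR]
  split_ifs with h
  · subst h; simp
  · obtain ⟨i, hi⟩ := Function.ne_iff.1 h
    exact Finset.prod_eq_zero (Finset.mem_univ i) (if_neg hi)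

lemma integrable_hermiteProd (n : ι → ℕ) (m : ι → ℝ) (v : ι → ℝ≥0) :
    Integrable (hermiteProd n) (Measure.pi fun i => gaussianReal (m i) (v i)) :=
  Integrable.fintype_prod (f := fun i x => (hermiteR (n i)).eval x)
    fun _ => integrable_eval_gaussianReal _ _ _

/-- **Mehler's formula** for products of Hermite polynomials. -/
lemma integral_hermiteProd (n : ι → ℕ) (ρ x : ι → ℝ) (v : ι → ℝ≥0)
    (hv : ∀ i, (v i : ℝ) = 1 - ρ i ^ 2) :
    ∫ y, hermiteProd n y ∂(Measure.pi fun i => gaussianReal (ρ i * x i) (v i))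
      = (∏ i, ρ i ^ n i) * hermiteProd n x := by
  simp_rw [hermiteProd]
  rw [integral_fintype_prod_eq_prod (f := fun i x => (hermiteR (n i)).eval x),
    ← Finset.prod_mul_distrib]
  exact Finset.prod_congr rfl fun i _ => integral_hermiteR_gaussianReal _ _ (hv i) _ _

lemma gaussianPi_eq_withDensity (m : ι → ℝ) {v : ι → ℝ≥0} (hv : ∀ i, v i ≠ 0)
    (hv2 : ∀ i, v i < 2) :
    Measure.pi (fun i => gaussianReal (m i) (v i))
      = (stdPi ι).withDensity
          fun x => ENNReal.ofReal (∏ i, gaussianRatio (m i) (v i) (x i)) :=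
  pi_eq_withDensity_prod (fun _ _ => gaussianRatio_nonneg _ _ _)
    (fun i => ((memLp_two_iff_integrable_sq
      (measurable_gaussianRatio _ _).aestronglyMeasurable).2
        (integrable_gaussianRatio_sq _ (hv i) (hv2 i))).integrable one_le_two)
    fun i => gaussianReal_eq_withDensity_gaussianRatio _ (hv i)

lemma memLp_gaussianRatio_prod (m : ι → ℝ) {v : ι → ℝ≥0} (hv : ∀ i, v i ≠ 0)
    (hv2 : ∀ i, v i < 2) :
    MemLp (fun x : ι → ℝ => ∏ i, gaussianRatio (m i) (v i) (x i)) 2 (stdPi ι) :=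
  memLp_two_prod (fun _ => measurable_gaussianRatio _ _)
    fun i => integrable_gaussianRatio_sq _ (hv i) (hv2 i)

/-! ### Completeness of the Hermite system. -/

section Completeness

variable {g : (ι → ℝ) → ℝ}

/-- Against a square integrable `g`, this function dominates all partial sums of the series of
`exp(i a·x)`. Its square is controlled by `e^{2|y|} ≤ e^{2y} + e^{-2y}`. -/
lemma memLp_exp_abs_linear (a : ι → ℝ) :
    MemLp (fun x : ι → ℝ => Real.exp (∑ i, |a i * x i|)) 2 (stdPi ι) := by
  simp_rw [Real.exp_sum]
  refine memLp_two_prod (f := fun i x => Real.exp |a i * x|) (fun i => by fun_prop) fun i => ?_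
  refine Integrable.mono' ((integrable_exp_mul_gaussianReal (2 * a i)).add
    (integrable_exp_mul_gaussianReal (-(2 * a i)))) (Measurable.aestronglyMeasurable (by fun_prop))
    (ae_of_all _ fun x => ?_)
  rw [Real.norm_eq_abs, abs_of_nonneg (by positivity), ← Real.exp_nat_mul, Pi.add_apply]
  rcases abs_cases (a i * x) with ⟨h, _⟩ | ⟨h, _⟩ <;> rw [h]
  · have : ((2 : ℕ) : ℝ) * (a i * x) = 2 * a i * x := by push_cast; ring
    rw [this]; linarith [Real.exp_pos (-(2 * a i) * x)]
  · have : ((2 : ℕ) : ℝ) * -(a i * x) = -(2 * a i) * x := by push_cast; ring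
    rw [this]; linarith [Real.exp_pos (2 * a i * x)]

/-- Each power is a combination of Hermite polynomials, hence each monomial is one of their
products; integrability is Cauchy-Schwarz. -/
lemma integral_monomial_mul_eq_zero (hg : MemLp g 2 (stdPi ι))
    (h : ∀ n, ∫ x, hermiteProd n x * g x ∂stdPi ι = 0) (n : ι → ℕ) :
    Integrable (fun x => (∏ i, x i ^ n i) * g x) (stdPi ι) ∧
      ∫ x, (∏ i, x i ^ n i) * g x ∂stdPi ι = 0 := by
  classical
  have hc : ∀ k : ℕ, ∃ c : ℕ → ℝ, ∀ x : ℝ,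
      x ^ k = ∑ j ∈ Finset.range (k + 1), c j * (hermiteR j).eval x := by
    intro k
    obtain ⟨c, hc⟩ := exists_hermite_expansion k (Polynomial.X ^ k) (by simp)
    refine ⟨c, fun x => ?_⟩
    have := congrArg (Polynomial.eval x) hc
    simpa [Polynomial.eval_finsetSum] using this
  choose c hc using hc
  have e : (fun x : ι → ℝ => (∏ i, x i ^ n i) * g x)
      = fun x => ∑ m ∈ Fintype.piFinset fun i => Finset.range (n i + 1),
          (∏ i, c (n i) (m i)) * (hermiteProd m x * g x) := by
    ext x
    simp_rw [hc]
    rw [Finset.prod_univ_sum, Finset.sum_mul]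
    refine Finset.sum_congr rfl fun m _ => ?_
    rw [Finset.prod_mul_distrib, hermiteProd, mul_assoc]
  have hint : ∀ m : ι → ℕ, Integrable (fun x => hermiteProd m x * g x) (stdPi ι) :=
    fun m => (memLp_hermiteProd m).integrable_mul hg
  rw [e]
  refine ⟨integrable_finsetSum _ fun m _ => (hint m).const_mul _, ?_⟩
  rw [integral_finsetSum _ fun m _ => (hint m).const_mul _]
  simp_rw [integral_const_mul, h]
  simp

lemma integral_linear_pow_mul_eq_zero (hg : MemLp g 2 (stdPi ι))
    (h : ∀ n, ∫ x, hermiteProd n x * g x ∂stdPi ι = 0) (a : ι → ℝ) (k : ℕ) :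
    Integrable (fun x => (∑ i, a i * x i) ^ k * g x) (stdPi ι) ∧
      ∫ x, (∑ i, a i * x i) ^ k * g x ∂stdPi ι = 0 := by
  have hm := integral_monomial_mul_eq_zero hg h
  set p : MvPolynomial ι ℝ := (∑ i, MvPolynomial.C (a i) * MvPolynomial.X i) ^ k with hp
  have e : (fun x : ι → ℝ => (∑ i, a i * x i) ^ k * g x)
      = fun x => ∑ d ∈ p.support, p.coeff d * ((∏ i, x i ^ d i) * g x) := by
    ext x
    have : (∑ i, a i * x i) ^ k = MvPolynomial.eval x p := by simp [hp]
    rw [this, MvPolynomial.eval_eq', Finset.sum_mul]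
    simp_rw [mul_assoc]
  rw [e]
  refine ⟨integrable_finsetSum _ fun d _ => (hm d).1.const_mul _, ?_⟩
  rw [integral_finsetSum _ fun (d : ι →₀ ℕ) _ => (hm d).1.const_mul _]
  simp_rw [integral_const_mul, fun d : ι →₀ ℕ => (hm d).2]
  simp

/-- The exponential series is integrated termwise by dominated convergence; every term vanishes
because `g` is orthogonal to powers of linear forms. -/
lemma integral_cexp_linear_mul_eq_zero (hg : MemLp g 2 (stdPi ι))
    (h : ∀ n, ∫ x, hermiteProd n x * g x ∂stdPi ι = 0) (a : ι → ℝ) :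
    ∫ x, Complex.exp ((∑ i, a i * x i : ℝ) * Complex.I) * (g x : ℂ) ∂stdPi ι = 0 := by
  set s : (ι → ℝ) → ℝ := fun x => ∑ i, a i * x i with hs
  have hpow := integral_linear_pow_mul_eq_zero hg h a
  let F : ℕ → (ι → ℝ) → ℂ := fun N x =>
    ∑ k ∈ Finset.range N, Complex.I ^ k / (k.factorial : ℂ) * ((s x ^ k * g x : ℝ) : ℂ)
  have hFe : ∀ N x, F N x
      = (∑ k ∈ Finset.range N, ((s x : ℂ) * Complex.I) ^ k / (k.factorial : ℂ)) * (g x : ℂ) := by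
    intro N x
    simp only [F]
    rw [Finset.sum_mul]
    refine Finset.sum_congr rfl fun k _ => ?_
    push_cast; ring
  have hFi : ∀ N, Integrable (F N) (stdPi ι) := fun N =>
    integrable_finsetSum _ fun k _ => ((hpow k).1.ofReal).const_mul _
  have hF0 : ∀ N, ∫ x, F N x ∂stdPi ι = 0 := by
    intro N
    rw [integral_finsetSum _ fun k _ => ((hpow k).1.ofReal).const_mul _]
    refine Finset.sum_eq_zero fun k _ => ?_
    rw [integral_const_mul, integral_complex_ofReal, (hpow k).2]
    simp
  have hb : Integrable (fun x => Real.exp (∑ i, |a i * x i|) * ‖g x‖) (stdPi ι) :=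
    (memLp_exp_abs_linear a).integrable_mul hg.norm
  have hlim := tendsto_integral_of_dominated_convergence (F := F)
    (f := fun x => Complex.exp ((s x : ℂ) * Complex.I) * (g x : ℂ)) _
    (fun N => (hFi N).aestronglyMeasurable) hb
    (fun N => ae_of_all _ fun x => by
      rw [hFe, norm_mul, Complex.norm_real]
      refine mul_le_mul_of_nonneg_right ?_ (norm_nonneg _)
      calc ‖∑ k ∈ Finset.range N, ((s x : ℂ) * Complex.I) ^ k / (k.factorial : ℂ)‖
          ≤ ∑ k ∈ Finset.range N, |s x| ^ k / (k.factorial : ℝ) := by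
            refine (norm_sum_le _ _).trans (le_of_eq (Finset.sum_congr rfl fun k _ => ?_))
            simp
        _ ≤ Real.exp |s x| := Real.sum_le_exp_of_nonneg (abs_nonneg _) N
        _ ≤ _ := Real.exp_le_exp.2 (Finset.abs_sum_le_sum_abs _ _))
    (ae_of_all _ fun x => by
      simp_rw [hFe]
      refine Filter.Tendsto.mul_const _ ?_
      have := (NormedSpace.expSeries_div_hasSum_exp ((s x : ℂ) * Complex.I)).tendsto_sum_nat
      rwa [← Complex.exp_eq_exp_ℂ] at this)
  simp_rw [hF0] at hlim
  exact (tendsto_nhds_unique hlim tendsto_const_nhds)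

/-- A square integrable function which is orthogonal to all the products of Hermite polynomials
vanishes. -/
lemma ae_eq_zero_of_integral_hermiteProd_eq_zero (hg : MemLp g 2 (stdPi ι))
    (h : ∀ n, ∫ x, hermiteProd n x * g x ∂stdPi ι = 0) : g =ᵐ[stdPi ι] 0 := by
  classical
  have hgi : Integrable g (stdPi ι) := hg.integrable one_le_two
  have hm : ∀ u : (ι → ℝ) → ℝ, Integrable u (stdPi ι) →
      AEMeasurable (fun x => ENNReal.ofReal (u x)) (stdPi ι) :=
    fun u hu => hu.aestronglyMeasurable.aemeasurable.ennreal_ofReal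
  have hfin : ∀ u : (ι → ℝ) → ℝ, Integrable u (stdPi ι) →
      IsFiniteMeasure ((stdPi ι).withDensity fun x => ENNReal.ofReal (u x)) :=
    fun u hu => isFiniteMeasure_withDensity_ofReal hu.2
  have := hfin g hgi
  have hgn : Integrable (fun x => -g x) (stdPi ι) := hgi.neg
  have := hfin _ hgn
  -- Uniqueness of characteristic functions concerns positive measures, so the measures with
  -- densities `g⁺` and `g⁻` are compared: the difference of their transforms is the Fourier
  -- transform of `g`, which is zero.
  have key : (stdPi ι).withDensity (fun x => ENNReal.ofReal (g x))
      = (stdPi ι).withDensity fun x => ENNReal.ofReal (-g x) := by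
    refine Measure.ext_of_charFunDual ?_
    ext L
    rw [charFunDual_apply, charFunDual_apply,
      integral_withDensity_eq_integral_toReal_smul₀ (hm _ hgi) (ae_of_all _ fun _ => by simp),
      integral_withDensity_eq_integral_toReal_smul₀ (hm _ hgn) (ae_of_all _ fun _ => by simp),
      ← sub_eq_zero]
    have hL : ∀ x : ι → ℝ, L x = ∑ i, L (Pi.single i 1) * x i := by
      intro x
      conv_lhs => rw [← Finset.univ_sum_single x, map_sum]
      refine Finset.sum_congr rfl fun i _ => ?_
      have : Pi.single i (x i) = x i • (Pi.single i (1 : ℝ) : ι → ℝ) := by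
        rw [← Pi.single_smul]; simp
      rw [this, map_smul, smul_eq_mul, mul_comm]
    have hi : ∀ u : (ι → ℝ) → ℝ, Integrable u (stdPi ι) → Integrable
        (fun x => (ENNReal.ofReal (u x)).toReal • Complex.exp (L x * Complex.I)) (stdPi ι) := by
      intro u hu
      refine hu.norm.mono' ((hm u hu).ennreal_toReal.aestronglyMeasurable.smul
        (Measurable.aestronglyMeasurable (by fun_prop))) (ae_of_all _ fun x => ?_)
      rw [norm_smul, Complex.norm_exp_ofReal_mul_I, mul_one, ENNReal.toReal_ofReal', Real.norm_eq_abs,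
        Real.norm_eq_abs, abs_of_nonneg (le_max_right _ _)]
      exact max_le (le_abs_self _) (abs_nonneg _)
    rw [← integral_sub (hi _ hgi) (hi _ hgn)]
    rw [← integral_cexp_linear_mul_eq_zero hg h fun i => L (Pi.single i 1)]
    congr 1; ext x
    rw [← hL x, ← sub_smul, ENNReal.toReal_ofReal', ENNReal.toReal_ofReal',
      mul_comm (Complex.exp _), ← Complex.real_smul]
    congr 1
    rcases le_total (g x) 0 with h0 | h0
    · rw [max_eq_right h0, max_eq_left (by linarith)]; ring
    · rw [max_eq_left h0, max_eq_right (by linarith)]; ring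
  rw [withDensity_eq_iff (hm _ hgi) (hm _ hgn) hgi.lintegral_lt_top.ne] at key
  filter_upwards [key] with x hx
  have h1 := congrArg ENNReal.toReal hx
  rw [ENNReal.toReal_ofReal', ENNReal.toReal_ofReal'] at h1
  rcases le_total (g x) 0 with h0 | h0
  · rw [max_eq_right h0, max_eq_left (by linarith)] at h1; simp; linarith
  · rw [max_eq_left h0, max_eq_right (by linarith)] at h1; simpa using h1

end Completeness

end Product

end HDiffusion

namespace HDiffusion

/-! ### Symmetric matrices, conjugates of diagonal matrices, square roots. -/

section MatrixTools

variable {r : ℕ}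

lemma transpose_eq_of_isHermitian {H : Matrix (Fin r) (Fin r) ℝ} (hH : H.IsHermitian) : Hᵀ = H := by
  rw [← conjTranspose_eq_transpose_of_trivial]; exact hH

lemma isHermitian_of_transpose_eq {H : Matrix (Fin r) (Fin r) ℝ} (hH : Hᵀ = H) : H.IsHermitian := by
  rw [IsHermitian, conjTranspose_eq_transpose_of_trivial, hH]

/-- A symmetric matrix is orthogonally diagonalizable, with ranked eigenvalues. -/
lemma exists_orthogonal_diagonal {H : Matrix (Fin r) (Fin r) ℝ} (hH : H.IsHermitian) :
    ∃ U ∈ Matrix.orthogonalGroup (Fin r) ℝ, ∃ d : Fin r → ℝ, Monotone d ∧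
      H * U = U * diagonal d := by
  set σ : Equiv.Perm (Fin r) := Tuple.sort hH.eigenvalues with hσ
  refine ⟨(hH.eigenvectorUnitary : Matrix (Fin r) (Fin r) ℝ).submatrix id σ, ?_, hH.eigenvalues ∘ σ,
    Tuple.monotone_sort _, ?_⟩
  · rw [Matrix.mem_orthogonalGroup_iff']
    have h := (Matrix.mem_orthogonalGroup_iff' _ _).1 hH.eigenvectorUnitary.2
    have : ((hH.eigenvectorUnitary : Matrix (Fin r) (Fin r) ℝ).submatrix id σ)ᵀ *
        (hH.eigenvectorUnitary : Matrix (Fin r) (Fin r) ℝ).submatrix id σ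
        = ((hH.eigenvectorUnitary : Matrix (Fin r) (Fin r) ℝ)ᵀ * (hH.eigenvectorUnitary : Matrix (Fin r) (Fin r) ℝ)).submatrix σ σ := by
      ext i j; simp [Matrix.mul_apply]
    rw [this, h]
    ext i j; simp [Matrix.one_apply]
  · ext i j
    have h := congrFun (hH.mulVec_eigenvectorBasis (σ j)) i
    rw [mul_diagonal, Matrix.mul_apply]
    simp only [submatrix_apply, id, IsHermitian.eigenvectorUnitary_apply, Function.comp]
    simp only [mulVec, dotProduct, Pi.smul_apply, smul_eq_mul] at h
    rw [h, mul_comm]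

lemma orthogonal_mul_transpose {U : Matrix (Fin r) (Fin r) ℝ}
    (hU : U ∈ Matrix.orthogonalGroup (Fin r) ℝ) : U * Uᵀ = 1 :=
  (Matrix.mem_orthogonalGroup_iff _ _).1 hU

lemma transpose_mul_orthogonal {U : Matrix (Fin r) (Fin r) ℝ}
    (hU : U ∈ Matrix.orthogonalGroup (Fin r) ℝ) : Uᵀ * U = 1 :=
  (Matrix.mem_orthogonalGroup_iff' _ _).1 hU

/-- This form suits the Riccati equation, which tested on an eigenvector becomes a scalar identity
for the eigenvalue. -/
lemma posDef_of_eigenvalue_pos {H : Matrix (Fin r) (Fin r) ℝ} (hH : H.IsHermitian)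
    (h : ∀ (q : ℝ) (v : Fin r → ℝ), v ≠ 0 → H *ᵥ v = q • v → 0 < q) : H.PosDef := by
  rw [hH.posDef_iff_eigenvalues_pos]
  intro i
  refine h _ _ ?_ (hH.mulVec_eigenvectorBasis i)
  intro h0
  refine hH.eigenvectorBasis.orthonormal.ne_zero i ?_
  ext j; exact congrFun h0 j

lemma dotProduct_pos {H : Matrix (Fin r) (Fin r) ℝ} (hH : H.PosDef) {v : Fin r → ℝ} (hv : v ≠ 0) :
    0 < v ⬝ᵥ H *ᵥ v := by
  simpa using hH.dotProduct_mulVec_pos hv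

lemma dotProduct_nonneg' {H : Matrix (Fin r) (Fin r) ℝ} (hH : H.PosSemidef) (v : Fin r → ℝ) :
    0 ≤ v ⬝ᵥ H *ᵥ v := by
  simpa using hH.dotProduct_mulVec_nonneg v

lemma mulVec_eq_zero_of_dotProduct {H : Matrix (Fin r) (Fin r) ℝ} (hH : H.PosSemidef) {v : Fin r → ℝ}
    (h : v ⬝ᵥ H *ᵥ v = 0) : H *ᵥ v = 0 :=
  (hH.dotProduct_mulVec_zero_iff v).1 (by simpa using h)

lemma dotProduct_self_pos' {v : Fin r → ℝ} (hv : v ≠ 0) : 0 < v ⬝ᵥ v := by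
  simpa using dotProduct_pos (PosDef.one (n := Fin r) (R := ℝ)) hv

lemma dotProduct_mulVec_comm {H : Matrix (Fin r) (Fin r) ℝ} (hH : H.IsHermitian) (v w : Fin r → ℝ) :
    v ⬝ᵥ H *ᵥ w = (H *ᵥ v) ⬝ᵥ w := by
  rw [dotProduct_mulVec, ← mulVec_transpose, transpose_eq_of_isHermitian hH]

lemma posDef_sqrt {H : Matrix (Fin r) (Fin r) ℝ} (hH : H.PosDef) : (CFC.sqrt H).PosDef := by
  have h1 : (CFC.sqrt H).PosSemidef := (CFC.sqrt_nonneg H).posSemidef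
  have h2 : CFC.sqrt H * CFC.sqrt H = H := CFC.sqrt_mul_sqrt_self H hH.posSemidef.nonneg
  rw [h1.posDef_iff_isUnit]
  exact isUnit_of_mul_isUnit_left (h2.symm ▸ hH.isUnit)

lemma sqrt_mul_sqrt {H : Matrix (Fin r) (Fin r) ℝ} (hH : H.PosSemidef) : CFC.sqrt H * CFC.sqrt H = H :=
  CFC.sqrt_mul_sqrt_self H hH.nonneg

lemma sqrt_eq_of_mul_self {H K : Matrix (Fin r) (Fin r) ℝ} (hK : K.PosSemidef) (h : K * K = H) : CFC.sqrt H = K :=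
  CFC.sqrt_unique h hK.nonneg

lemma charpoly_conj_diagonal {G : Matrix (Fin r) (Fin r) ℝ} (hG : IsUnit G) (d : Fin r → ℝ) :
    (G * diagonal d * G⁻¹).charpoly = ∏ i, (Polynomial.X - Polynomial.C (d i)) := by
  rw [charpoly_mul_comm, ← mul_assoc, nonsing_inv_mul _ ((isUnit_iff_isUnit_det _).1 hG), one_mul,
    charpoly_diagonal]

lemma roots_charpoly_conj_diagonal {G : Matrix (Fin r) (Fin r) ℝ} (hG : IsUnit G) (d : Fin r → ℝ) :
    (G * diagonal d * G⁻¹).charpoly.roots = Finset.univ.val.map d := by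
  rw [charpoly_conj_diagonal hG, Polynomial.roots_prod _ _
    (by simp [Finset.prod_ne_zero_iff, Polynomial.X_sub_C_ne_zero])]
  simp

lemma hasPosEigenvalues_conj_diagonal {G : Matrix (Fin r) (Fin r) ℝ} (hG : IsUnit G) {d : Fin r → ℝ}
    (hd : ∀ i, 0 < d i) : HasPosEigenvalues (G * diagonal d * G⁻¹) := by
  refine ⟨?_, fun μ hμ => ?_⟩
  · rw [Polynomial.splits_iff_card_roots, roots_charpoly_conj_diagonal hG, charpoly_conj_diagonal hG,
      Polynomial.natDegree_prod_of_monic _ _ fun i _ => Polynomial.monic_X_sub_C _]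
    simp
  · rw [roots_charpoly_conj_diagonal hG] at hμ
    obtain ⟨i, -, rfl⟩ := Multiset.mem_map.1 hμ
    exact hd i

/-- By commutation `X` preserves the kernel of `X + diagonal d`, and there it acts as `-diagonal d`;
hence `p(X)` acts coordinatewise by `p(-d_i)`. -/
lemma aeval_mulVec_of_mulVec_eq {X : Matrix (Fin r) (Fin r) ℝ} {d : Fin r → ℝ} (hcomm : Commute X (diagonal d))
    (p : Polynomial ℝ) : ∀ v : Fin r → ℝ, X *ᵥ v = -(diagonal d *ᵥ v) →
      Polynomial.aeval X p *ᵥ v = fun i => p.eval (-d i) * v i := by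
  induction p using Polynomial.induction_on with
  | C a => intro v _; ext i; simp [Algebra.algebraMap_eq_smul_one, smul_mulVec]
  | add p q hp hq => intro v hv; ext i; simp [add_mulVec, hp v hv, hq v hv, add_mul]
  | monomial n a ih =>
    intro v hv
    have hv' : X *ᵥ (X *ᵥ v) = -(diagonal d *ᵥ (X *ᵥ v)) := by
      conv_lhs => rw [hv]
      rw [mulVec_neg, mulVec_mulVec, mulVec_mulVec, hcomm.eq]
    rw [pow_succ, ← mul_assoc, map_mul, Polynomial.aeval_X, ← mulVec_mulVec, ih _ hv', hv]
    ext i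
    simp [mulVec_diagonal]
    ring

/-- The square root with positive eigenvalues of a diagonalizable matrix with positive eigenvalues
is unique. -/
lemma isPosSqrt_conj_diagonal_unique {G : Matrix (Fin r) (Fin r) ℝ} (hG : IsUnit G) {d : Fin r → ℝ}
    (hd : ∀ i, 0 < d i) {X : Matrix (Fin r) (Fin r) ℝ} (hX : IsPosSqrt (G * diagonal (fun i => d i ^ 2) * G⁻¹) X) :
    X = G * diagonal d * G⁻¹ := by
  have hG' := (isUnit_iff_isUnit_det _).1 hG
  obtain ⟨hXX, -, hroots⟩ := hX
  set Z : Matrix (Fin r) (Fin r) ℝ := G⁻¹ * X * G with hZ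
  have hXZ : X = G * Z * G⁻¹ := by
    rw [hZ]; simp only [mul_assoc]; rw [mul_nonsing_inv _ hG', ← mul_assoc, mul_nonsing_inv _ hG']
    simp
  have hZZ : Z * Z = diagonal fun i => d i ^ 2 := by
    have : Z * Z = G⁻¹ * (X * X) * G := by
      rw [hZ]; simp only [mul_assoc]; rw [← mul_assoc G, mul_nonsing_inv _ hG', one_mul]
    rw [this, hXX]; simp only [mul_assoc]
    rw [nonsing_inv_mul _ hG', ← mul_assoc, nonsing_inv_mul _ hG']; simp
  have hchar : Z.charpoly = X.charpoly := by
    rw [hZ, charpoly_mul_comm, ← mul_assoc, mul_nonsing_inv _ hG', one_mul]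
  -- `Z` commutes with `Z² = diag(d_i²)`, so `Z_ij (d_j - d_i)(d_j + d_i) = 0`, and the last factor
  -- is positive.
  have hcomm : Commute Z (diagonal d) := by
    have h2 : Z * diagonal (fun i => d i ^ 2) = diagonal (fun i => d i ^ 2) * Z := by
      simp only [← hZZ]; exact (mul_assoc Z Z Z).symm
    ext i j
    have h3 := congrFun (congrFun h2 i) j
    rw [mul_diagonal, diagonal_mul] at h3 ⊢
    have h4 : Z i j * (d j - d i) * (d j + d i) = 0 := by linear_combination h3
    rcases mul_eq_zero.1 h4 with h5 | h5
    · linear_combination h5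
    · linarith [hd i, hd j]
  -- For a nonzero kernel vector, Cayley-Hamilton would make some `-d_i < 0` a root of the
  -- characteristic polynomial, whose roots are positive. Invertibility then turns `(Z - diagonal
  -- d)(Z + diagonal d) = 0` into `Z = diagonal d`.
  have hunit : IsUnit (Z + diagonal d) := by
    rw [isUnit_iff_isUnit_det, isUnit_iff_ne_zero]
    intro h0
    obtain ⟨v, hv, hv0⟩ := exists_mulVec_eq_zero_iff.2 h0
    have hv1 : Z *ᵥ v = -(diagonal d *ᵥ v) := by
      rw [add_mulVec] at hv0; exact eq_neg_of_add_eq_zero_left hv0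
    have h := aeval_mulVec_of_mulVec_eq hcomm Z.charpoly v hv1
    rw [aeval_self_charpoly, zero_mulVec] at h
    refine hv (funext fun i => ?_)
    have hi := congrFun h i
    simp only [Pi.zero_apply] at hi
    refine (mul_eq_zero.1 hi.symm).resolve_left fun h0 => ?_
    rw [hchar] at h0
    have := hroots _ ((Polynomial.mem_roots (charpoly_monic X).ne_zero).2 h0)
    linarith [hd i]
  have hprod : (Z - diagonal d) * (Z + diagonal d) = 0 := by
    have : diagonal d * diagonal d = diagonal fun i => d i ^ 2 := by
      rw [diagonal_mul_diagonal]; simp [sq]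
    rw [sub_mul, mul_add, mul_add, hZZ, this, hcomm.eq]; abel
  have : Z = diagonal d := by
    rw [← sub_eq_zero]
    exact (hunit.mul_left_eq_zero).1 hprod
  rw [hXZ, this]

end MatrixTools

/-! ### Observability. -/

section Controllability

variable {r : ℕ} {A S : Matrix (Fin r) (Fin r) ℝ}

/-- `S` and `S^(1/2)` have the same kernel, so `w` is orthogonal to all columns of the
controllability matrix of `(A', S^(1/2))`, and these span the space. -/
lemma eq_zero_of_observable (hS : S.PosSemidef) (hAS : IsControllable Aᵀ (CFC.sqrt S))
    {w : Fin r → ℝ} (hw : ∀ k : ℕ, S *ᵥ (A ^ k *ᵥ w) = 0) : w = 0 := by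
  set O := controllabilityMatrix Aᵀ (CFC.sqrt S) with hO
  have hSh : (CFC.sqrt S).PosSemidef := (CFC.sqrt_nonneg S).posSemidef
  have h1 : ∀ k : ℕ, CFC.sqrt S *ᵥ (A ^ k *ᵥ w) = 0 := by
    intro k
    have h := congrArg (fun u => (A ^ k *ᵥ w) ⬝ᵥ u) (hw k)
    simp only [dotProduct_zero] at h
    rw [← sqrt_mul_sqrt hS, ← mulVec_mulVec, dotProduct_mulVec_comm hSh.isHermitian] at h
    exact dotProduct_self_eq_zero.1 h
  have h2 : w ᵥ* O = 0 := by
    ext ⟨k, j⟩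
    have := congrFun (h1 k) j
    rw [mulVec_mulVec, ← transpose_eq_of_isHermitian hSh.isHermitian, ← transpose_transpose (A ^ _),
      ← transpose_mul, mulVec_transpose, transpose_pow] at this
    simpa [vecMul, dotProduct, hO, controllabilityMatrix] using this
  by_contra hne
  have h3 : (O * Oᵀ).det = 0 := by
    rw [← exists_vecMul_eq_zero_iff]
    exact ⟨w, hne, by rw [← vecMul_vecMul, h2, zero_vecMul]⟩
  have h4 : (O * Oᵀ).rank = r := by rw [rank_self_mul_transpose]; exact hAS
  have h5 : LinearMap.range (O * Oᵀ).mulVecLin = ⊤ :=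
    Submodule.eq_top_of_finrank_eq (by rw [← Matrix.rank, h4]; simp)
  have h6 : IsUnit (O * Oᵀ) := by
    rw [← mulVec_surjective_iff_isUnit]
    exact LinearMap.range_eq_top.1 h5
  exact ((isUnit_iff_isUnit_det _).1 h6).ne_zero h3

end Controllability

end HDiffusion

namespace HDiffusion

/-! ### The algebraic Riccati equation. -/

section Riccati

variable {r : ℕ} {A R S C : Matrix (Fin r) (Fin r) ℝ}

/-- Reversibility means that `A` is self-adjoint for the inner product given by `R⁻¹`; conjugation
by `R^(1/2)` turns this into ordinary symmetry. -/
lemma symm_conj (hC : C.PosDef) (hCC : C * C = R) (hrev : A * R = R * Aᵀ) :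
    C⁻¹ * A * C = C * Aᵀ * C⁻¹ := by
  have hdet := (isUnit_iff_isUnit_det _).1 hC.isUnit
  have h1 : C⁻¹ * (A * R) * C⁻¹ = C⁻¹ * A * C := by
    rw [← hCC, ← mul_assoc, ← mul_assoc, mul_nonsing_inv_cancel_right _ _ hdet]
  rw [← h1, hrev, ← hCC, ← mul_assoc, ← mul_assoc, nonsing_inv_mul _ hdet, one_mul]

lemma isHermitian_conj (hC : C.PosDef) (hCC : C * C = R) (hrev : A * R = R * Aᵀ) :
    (C⁻¹ * A * C).IsHermitian := by
  apply isHermitian_of_transpose_eq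
  rw [transpose_mul, transpose_mul, transpose_nonsing_inv, transpose_eq_of_isHermitian hC.1,
    ← mul_assoc, symm_conj hC hCC hrev]

lemma conj_pow (hC : IsUnit C.det) (k : ℕ) : (C⁻¹ * A * C) ^ k = C⁻¹ * A ^ k * C := by
  induction k with
  | zero => simp [nonsing_inv_mul _ hC]
  | succ k ih =>
    rw [pow_succ, ih, pow_succ]
    simp only [mul_assoc]
    rw [mul_nonsing_inv_cancel_left _ _ hC]

/-- The matrix `A² + R S`, not symmetric in general, is similar to `Ã² + S̃`, which is symmetric
under reversibility. -/
lemma conj_sq_add (hC : C.PosDef) (hCC : C * C = R) :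
    C * ((C⁻¹ * A * C) * (C⁻¹ * A * C) + C * S * C) * C⁻¹ = A ^ 2 + R * S := by
  have hdet := (isUnit_iff_isUnit_det _).1 hC.isUnit
  have h : C * (C⁻¹ * A * C) = A * C := by
    rw [← mul_assoc, mul_nonsing_inv_cancel_left _ _ hdet]
  rw [mul_add, add_mul, ← mul_assoc C, h, mul_assoc A, h, ← mul_assoc A,
    mul_nonsing_inv_cancel_right _ _ hdet, ← hCC, sq]
  simp only [← mul_assoc]
  rw [mul_nonsing_inv_cancel_right _ _ hdet]

/-- The Riccati equation in the coordinates in which `R` is the identity. -/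
lemma riccati_conj (hC : C.PosDef) (hCC : C * C = R) (hrev : A * R = R * Aᵀ)
    (Q : Matrix (Fin r) (Fin r) ℝ) :
    C * (Aᵀ * Q + Q * A - Q * R * Q + S) * C
      = (C⁻¹ * A * C) * (C * Q * C) + (C * Q * C) * (C⁻¹ * A * C)
        - (C * Q * C) * (C * Q * C) + C * S * C := by
  have hdet := (isUnit_iff_isUnit_det _).1 hC.isUnit
  have h1 : (C⁻¹ * A * C) * (C * Q * C) = C * (Aᵀ * Q) * C := by
    rw [symm_conj hC hCC hrev]
    simp only [mul_assoc]
    rw [nonsing_inv_mul_cancel_left _ _ hdet]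
  have h2 : (C * Q * C) * (C⁻¹ * A * C) = C * (Q * A) * C := by
    simp only [mul_assoc]
    rw [mul_nonsing_inv_cancel_left _ _ hdet]
  have h3 : (C * Q * C) * (C * Q * C) = C * (Q * R * Q) * C := by
    rw [← hCC]; simp only [mul_assoc]
  rw [h1, h2, h3]
  simp only [mul_add, add_mul, mul_sub, sub_mul]

lemma posSemidef_conj (hC : C.PosDef) (hS : S.PosSemidef) : (C * S * C).PosSemidef := by
  have := hS.mul_mul_conjTranspose_same C
  rwa [hC.1.eq] at this

lemma observable_conj (hC : C.PosDef) (hS : S.PosSemidef)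
    (hAS : IsControllable Aᵀ (CFC.sqrt S)) {v : Fin r → ℝ}
    (h : ∀ k : ℕ, (C * S * C) *ᵥ ((C⁻¹ * A * C) ^ k *ᵥ v) = 0) : v = 0 := by
  have hdet := (isUnit_iff_isUnit_det _).1 hC.isUnit
  have hinj := mulVec_injective_iff_isUnit.2 hC.isUnit
  apply hinj
  rw [mulVec_zero]
  refine eq_zero_of_observable hS hAS fun k => ?_
  apply hinj
  rw [mulVec_zero, ← h k, conj_pow hdet]
  simp only [mulVec_mulVec, mul_assoc]
  rw [mul_nonsing_inv_cancel_left _ _ hdet]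

/-- The quadratic form is `|Ã v|² + v'S̃v`. Where it vanishes, `Ã v = 0` and `S̃ v = 0`, so `v` is
unobservable. -/
lemma posDef_conj_sq_add (hC : C.PosDef) (hCC : C * C = R) (hrev : A * R = R * Aᵀ)
    (hS : S.PosSemidef) (hAS : IsControllable Aᵀ (CFC.sqrt S)) :
    ((C⁻¹ * A * C) * (C⁻¹ * A * C) + C * S * C).PosDef := by
  have hAt := isHermitian_conj hC hCC hrev
  have hSt := posSemidef_conj hC hS
  have hobs := fun v => observable_conj (A := A) (v := v) hC hS hAS
  set At := C⁻¹ * A * C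
  set St := C * S * C
  have hherm : (At * At + St).IsHermitian :=
    isHermitian_of_transpose_eq (by
      rw [transpose_add, transpose_mul, transpose_eq_of_isHermitian hAt,
        transpose_eq_of_isHermitian hSt.1])
  have hq : ∀ v : Fin r → ℝ, v ⬝ᵥ (At * At + St) *ᵥ v = (At *ᵥ v) ⬝ᵥ (At *ᵥ v) + v ⬝ᵥ St *ᵥ v := by
    intro v
    rw [add_mulVec, dotProduct_add, ← mulVec_mulVec, dotProduct_mulVec_comm hAt]
  refine PosDef.of_dotProduct_mulVec_pos hherm fun v hv => ?_
  rw [star_trivial, hq]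
  have h1 : 0 ≤ (At *ᵥ v) ⬝ᵥ (At *ᵥ v) := Finset.sum_nonneg fun i _ => mul_self_nonneg _
  have h2 := dotProduct_nonneg' hSt v
  refine lt_of_le_of_ne (add_nonneg h1 h2) fun h0 => hv (hobs v fun k => ?_)
  have h3 : At *ᵥ v = 0 := dotProduct_self_eq_zero.1 (by linarith)
  have h4 : St *ᵥ v = 0 := mulVec_eq_zero_of_dotProduct hSt (by linarith)
  cases k with
  | zero => simpa using h4
  | succ k => rw [pow_succ, ← mulVec_mulVec v (At ^ k) At, h3, mulVec_zero, mulVec_zero]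

/-- `Ã + (Ã² + S̃)^(1/2)` is positive definite. -/
lemma posDef_add_sqrt (hC : C.PosDef) (hCC : C * C = R) (hrev : A * R = R * Aᵀ)
    (hS : S.PosSemidef) (hAS : IsControllable Aᵀ (CFC.sqrt S)) {Y : Matrix (Fin r) (Fin r) ℝ}
    (hY : Y.PosDef) (hYY : Y * Y = (C⁻¹ * A * C) * (C⁻¹ * A * C) + C * S * C) :
    (C⁻¹ * A * C + Y).PosDef := by
  have hAt := isHermitian_conj hC hCC hrev
  have hSt := posSemidef_conj hC hS
  have hobs := fun v => observable_conj (A := A) (v := v) hC hS hAS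
  set At := C⁻¹ * A * C
  set St := C * S * C
  set Q := At + Y with hQ
  have hQh : Q.IsHermitian := hAt.add hY.1
  -- The Riccati equation in Lyapunov form. On an eigenvector `Q v = q v` it reads `q²|v|² + v'S̃v =
  -- 2q v'Yv`, which excludes `q < 0`.
  have hric : Q * Q + St = Y * Q + Q * Y := by
    rw [hQ]; simp only [add_mul, mul_add]; rw [hYY]; abel
  -- The kernel of `Q` is stable under `Ã` and lies in that of `S̃`; observability therefore
  -- excludes `q = 0`.
  have hker : ∀ w, Q *ᵥ w = 0 → St *ᵥ w = 0 ∧ Q *ᵥ (At *ᵥ w) = 0 := by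
    intro w hw
    have h1 : St *ᵥ w = Q *ᵥ (Y *ᵥ w) := by
      have := congrArg (fun X => X *ᵥ w) hric
      simpa only [add_mulVec, ← mulVec_mulVec, hw, mulVec_zero, zero_add] using this
    have h2 : St *ᵥ w = 0 := by
      refine mulVec_eq_zero_of_dotProduct hSt ?_
      rw [h1, dotProduct_mulVec_comm hQh, hw, zero_dotProduct]
    refine ⟨h2, ?_⟩
    have h3 : At = Q - Y := by rw [hQ, add_sub_cancel_right]
    rw [h3, sub_mulVec, hw, zero_sub, mulVec_neg, ← h1, h2, neg_zero]
  refine posDef_of_eigenvalue_pos hQh fun q v hv hqv => ?_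
  have h1 : v ⬝ᵥ (Q * Q + St) *ᵥ v = q ^ 2 * (v ⬝ᵥ v) + v ⬝ᵥ St *ᵥ v := by
    rw [add_mulVec, dotProduct_add, ← mulVec_mulVec, hqv, mulVec_smul, hqv, dotProduct_smul,
      dotProduct_smul, smul_eq_mul, smul_eq_mul]
    ring
  have h2 : v ⬝ᵥ (Y * Q + Q * Y) *ᵥ v = 2 * q * (v ⬝ᵥ Y *ᵥ v) := by
    rw [add_mulVec, dotProduct_add, ← mulVec_mulVec, ← mulVec_mulVec,
      dotProduct_mulVec_comm hQh v (Y *ᵥ v), hqv, mulVec_smul, dotProduct_smul, smul_dotProduct,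
      smul_eq_mul]
    ring
  have h3 := dotProduct_pos hY hv
  have h4 := dotProduct_nonneg' hSt v
  have h5 := dotProduct_self_pos' hv
  rw [hric, h2] at h1
  have hq0 : 0 ≤ q := by
    by_contra hneg
    have h6 : 2 * q * (v ⬝ᵥ Y *ᵥ v) < 0 := mul_neg_of_neg_of_pos (by linarith) h3
    have h7 : 0 ≤ q ^ 2 * (v ⬝ᵥ v) := by positivity
    linarith
  refine lt_of_le_of_ne hq0 fun h0 => hv (hobs v fun k => ?_)
  rw [← h0, zero_smul] at hqv
  have hk : ∀ k : ℕ, Q *ᵥ (At ^ k *ᵥ v) = 0 := by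
    intro k
    induction k with
    | zero => simpa using hqv
    | succ k ih => rw [pow_succ', ← mulVec_mulVec v At (At ^ k)]; exact (hker _ ih).2
  exact (hker _ (hk k)).1

/-- A positive definite solution `Q` of the Riccati equation satisfies
`Q̃ = Ã + (Ã² + S̃)^(1/2)`. -/
lemma riccati_solution_eq (hC : C.PosDef) (hCC : C * C = R) (hrev : A * R = R * Aᵀ)
    (hS : S.PosSemidef) {Q : Matrix (Fin r) (Fin r) ℝ} (hQ : IsRiccatiSolution A R S Q) :
    C * Q * C = C⁻¹ * A * C
      + CFC.sqrt ((C⁻¹ * A * C) * (C⁻¹ * A * C) + C * S * C) := by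
  have hAt := isHermitian_conj hC hCC hrev
  have hSt := posSemidef_conj hC hS
  have hQt : (C * Q * C).PosDef := by
    have := hQ.1.mul_mul_conjTranspose_same (B := C)
      (vecMul_injective_iff_isUnit.2 hC.isUnit)
    rwa [hC.1.eq] at this
  have hric := riccati_conj (S := S) hC hCC hrev Q
  rw [hQ.2, mul_zero, zero_mul] at hric
  set At := C⁻¹ * A * C
  set St := C * S * C
  set Qt := C * Q * C
  clear_value At St Qt
  set Y := Qt - At with hY
  have hYh : Y.IsHermitian := hQt.1.sub hAt
  have hYY : Y * Y = At * At + St := by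
    rw [hY]; simp only [sub_mul, mul_sub]
    rw [← sub_eq_zero, ← neg_eq_zero]
    rw [hric]; abel
  have h2 : Qt * Qt + St = Y * Qt + Qt * Y := by
    rw [hY]; simp only [sub_mul, mul_sub]
    rw [← sub_eq_zero]
    rw [hric]; abel
  -- `Y` is already a symmetric square root of `Ã² + S̃`; only its sign is at stake. For `Y v = q v`
  -- the Lyapunov form gives `|Q̃v|² + v'S̃v = 2q v'Q̃v`, where the left side and `v'Q̃v` are
  -- positive.
  have hYpos : Y.PosDef := by
    refine posDef_of_eigenvalue_pos hYh fun q v hv hqv => ?_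
    have h3 : v ⬝ᵥ (Qt * Qt + St) *ᵥ v = (Qt *ᵥ v) ⬝ᵥ (Qt *ᵥ v) + v ⬝ᵥ St *ᵥ v := by
      rw [add_mulVec, dotProduct_add, ← mulVec_mulVec, dotProduct_mulVec_comm hQt.1]
    have h4 : v ⬝ᵥ (Y * Qt + Qt * Y) *ᵥ v = 2 * q * (v ⬝ᵥ Qt *ᵥ v) := by
      rw [add_mulVec, dotProduct_add, ← mulVec_mulVec, ← mulVec_mulVec,
        dotProduct_mulVec_comm hYh v (Qt *ᵥ v), hqv, mulVec_smul, dotProduct_smul,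
        smul_dotProduct, smul_eq_mul]
      ring
    rw [h2, h4] at h3
    have h5 := dotProduct_pos hQt hv
    have h6 := dotProduct_nonneg' hSt v
    have h7 : Qt *ᵥ v ≠ 0 := fun h0 => by rw [h0, dotProduct_zero] at h5; exact lt_irrefl _ h5
    have h8 := dotProduct_self_pos' h7
    by_contra hneg
    have : 2 * q * (v ⬝ᵥ Qt *ᵥ v) ≤ 0 := mul_nonpos_of_nonpos_of_nonneg (by linarith) h5.le
    linarith
  rw [sqrt_eq_of_mul_self hYpos.posSemidef hYY, hY]
  abel

/-- Existence and uniqueness for the Riccati equation, and the resulting form of the drift. -/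
theorem riccati_structure (hR : R.PosDef) (hS : S.PosSemidef)
    (hAS : IsControllable Aᵀ (CFC.sqrt S)) (hrev : A * R = R * Aᵀ) :
    (∃! Q, IsRiccatiSolution A R S Q) ∧
    ∃ C Y : Matrix (Fin r) (Fin r) ℝ, C.PosDef ∧ Y.PosDef ∧ C * C = R ∧
      A ^ 2 + R * S = C * (Y * Y) * C⁻¹ ∧ drift A R S = -(C * Y * C⁻¹) := by
  set C := CFC.sqrt R
  have hC : C.PosDef := posDef_sqrt hR
  have hCC : C * C = R := sqrt_mul_sqrt hR.posSemidef
  have hdet := (isUnit_iff_isUnit_det _).1 hC.isUnit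
  have hT := posDef_conj_sq_add hC hCC hrev hS hAS
  have hsq := conj_sq_add (A := A) (S := S) hC hCC
  have hsol := fun Q => riccati_solution_eq (Q := Q) hC hCC hrev hS
  set Y := CFC.sqrt ((C⁻¹ * A * C) * (C⁻¹ * A * C) + C * S * C)
  have hY : Y.PosDef := posDef_sqrt hT
  have hYY : Y * Y = (C⁻¹ * A * C) * (C⁻¹ * A * C) + C * S * C := sqrt_mul_sqrt hT.posSemidef
  have hcancel : ∀ X : Matrix (Fin r) (Fin r) ℝ, C⁻¹ * (C * X * C) * C⁻¹ = X := by
    intro X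
    rw [mul_assoc C, nonsing_inv_mul_cancel_left _ _ hdet, mul_nonsing_inv_cancel_right _ _ hdet]
  have hex : IsRiccatiSolution A R S (C⁻¹ * (C⁻¹ * A * C + Y) * C⁻¹) := by
    have hc : C * (C⁻¹ * (C⁻¹ * A * C + Y) * C⁻¹) * C = C⁻¹ * A * C + Y := by
      rw [mul_assoc C⁻¹, mul_nonsing_inv_cancel_left _ _ hdet,
        nonsing_inv_mul_cancel_right _ _ hdet]
    refine ⟨?_, ?_⟩
    · have := (posDef_add_sqrt hC hCC hrev hS hAS hY hYY).mul_mul_conjTranspose_same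
        (B := C⁻¹) (vecMul_injective_iff_isUnit.2 hC.inv.isUnit)
      rwa [hC.inv.1.eq] at this
    · rw [← hcancel (_ + S), riccati_conj hC hCC hrev, hc]
      have : (C⁻¹ * A * C) * (C⁻¹ * A * C + Y) + (C⁻¹ * A * C + Y) * (C⁻¹ * A * C)
          - (C⁻¹ * A * C + Y) * (C⁻¹ * A * C + Y) + C * S * C = 0 := by
        generalize C⁻¹ * A * C = At at *
        simp only [mul_add, add_mul]; rw [hYY]; abel
      rw [this]; simp
  have huniq : ∀ Q, IsRiccatiSolution A R S Q → Q = C⁻¹ * (C⁻¹ * A * C + Y) * C⁻¹ := by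
    intro Q hQ
    rw [← hsol Q hQ, hcancel]
  refine ⟨⟨_, hex, huniq⟩, C, Y, hC, hY, hCC, ?_, ?_⟩
  · rw [hYY, hsq]
  · have hQ : Qinf A R S = C⁻¹ * (C⁻¹ * A * C + Y) * C⁻¹ := by
      refine huniq _ ?_
      have h : ∃ Q, IsRiccatiSolution A R S Q := ⟨_, hex⟩
      rw [Qinf, dif_pos h]
      exact h.choose_spec
    -- Substituting `Q_∞`, the term `R Q_∞` is `A + C Y C⁻¹`, so `A` cancels in the drift.
    rw [drift, hQ, ← hCC]
    simp only [mul_add, add_mul, mul_assoc]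
    rw [mul_nonsing_inv_cancel_left _ _ hdet, mul_nonsing_inv_cancel_left _ _ hdet,
      mul_nonsing_inv_cancel_left _ _ hdet, mul_nonsing_inv _ hdet]
    simp

end Riccati

end HDiffusion

namespace HDiffusion

/-! ### Gramians of a diagonalized drift. -/

section Gramian

variable {r : ℕ}

lemma exp_smul_conj_diagonal {G M : Matrix (Fin r) (Fin r) ℝ} (hG : IsUnit G) {l : Fin r → ℝ}
    (hM : M = -(G * diagonal l * G⁻¹)) (s : ℝ) :
    NormedSpace.exp (s • M) = G * diagonal (fun i => Real.exp (-(l i * s))) * G⁻¹ := by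
  have : s • M = G * diagonal (fun i => -(l i * s)) * G⁻¹ := by
    rw [hM, smul_neg, ← smul_mul_assoc, ← mul_smul_comm, ← diagonal_smul, ← neg_mul, ← mul_neg,
      diagonal_neg]
    congr 3; ext i; simp [mul_comm]
  rw [this, exp_conj _ _ hG, exp_diagonal, Pi.exp_def]
  simp_rw [Real.exp_eq_exp_ℝ]

/-- The factor `G⁻¹` ending `e^{sM}` cancels the `G` opening `R`, and likewise on the transposed
side: one `G` diagonalizes all times at once. -/
lemma gramIntegrand_conj_diagonal {G M R : Matrix (Fin r) (Fin r) ℝ} (hG : IsUnit G)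
    {l w : Fin r → ℝ} (hM : M = -(G * diagonal l * G⁻¹)) (hR : R = G * diagonal w * Gᵀ) (s : ℝ) :
    gramIntegrand M R s = G * diagonal (fun i => w i * Real.exp (-(2 * l i) * s)) * Gᵀ := by
  have hdet := (isUnit_iff_isUnit_det _).1 hG
  have hdet' : IsUnit Gᵀ.det := by rwa [det_transpose]
  rw [gramIntegrand, ← transpose_smul, exp_transpose, exp_smul_conj_diagonal hG hM, hR]
  simp only [transpose_mul, diagonal_transpose, transpose_nonsing_inv, mul_assoc]
  rw [nonsing_inv_mul_cancel_left _ _ hdet, mul_nonsing_inv_cancel_left _ _ hdet',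
    ← mul_assoc (diagonal w), diagonal_mul_diagonal, ← mul_assoc (diagonal _) (diagonal _),
    diagonal_mul_diagonal]
  congr 3; ext i
  rw [mul_left_comm, ← Real.exp_add]; congr 2; ring

lemma mul_diagonal_mul_transpose_apply (G : Matrix (Fin r) (Fin r) ℝ) (d : Fin r → ℝ)
    (i j : Fin r) : (G * diagonal d * Gᵀ) i j = ∑ k, G i k * G j k * d k := by
  rw [mul_apply]
  refine Finset.sum_congr rfl fun k _ => ?_
  rw [mul_diagonal, transpose_apply]; ring

lemma integrableOn_gramIntegrand {G M R : Matrix (Fin r) (Fin r) ℝ} (hG : IsUnit G)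
    {l w : Fin r → ℝ} (hl : ∀ i, 0 < l i) (hM : M = -(G * diagonal l * G⁻¹))
    (hR : R = G * diagonal w * Gᵀ) (i j : Fin r) :
    IntegrableOn (fun s => gramIntegrand M R s i j) (Set.Ioi 0) ∧
      ∫ s in Set.Ioi (0 : ℝ), gramIntegrand M R s i j
        = (G * diagonal (fun i => w i / (2 * l i)) * Gᵀ) i j := by
  simp_rw [gramIntegrand_conj_diagonal hG hM hR, mul_diagonal_mul_transpose_apply]
  have hneg : ∀ k, -(2 * l k) < 0 := fun k => by linarith [hl k]
  have hi : ∀ k, IntegrableOn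
      (fun s => G i k * G j k * (w k * Real.exp (-(2 * l k) * s))) (Set.Ioi 0) := fun k =>
    ((integrableOn_exp_mul_Ioi (hneg k) 0).const_mul _).const_mul _
  refine ⟨integrable_finsetSum _ fun k _ => hi k, ?_⟩
  rw [integral_finsetSum _ fun k _ => hi k]
  refine Finset.sum_congr rfl fun k _ => ?_
  rw [integral_const_mul, integral_const_mul, integral_exp_mul_Ioi (hneg k)]
  have := (hl k).ne'
  simp only [mul_zero, Real.exp_zero, neg_div_neg_eq]
  field_simp

/-- The weights `2 l_i` normalize the limiting variances to 1, so that the limit as `t → ∞` for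
positive `l_i` is `G G'`. -/
lemma integral_gramIntegrand {G M R : Matrix (Fin r) (Fin r) ℝ} (hG : IsUnit G)
    {l : Fin r → ℝ} (hM : M = -(G * diagonal l * G⁻¹))
    (hR : R = G * diagonal (fun i => 2 * l i) * Gᵀ) (t : ℝ) (i j : Fin r) :
    ∫ s in (0 : ℝ)..t, gramIntegrand M R s i j
      = (G * diagonal (fun i => 1 - Real.exp (-(l i * t)) ^ 2) * Gᵀ : Matrix (Fin r) (Fin r) ℝ)
        i j := by
  simp_rw [gramIntegrand_conj_diagonal hG hM hR, mul_diagonal_mul_transpose_apply]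
  rw [intervalIntegral.integral_finsetSum
    fun k _ => Continuous.intervalIntegrable (by fun_prop) _ _]
  refine Finset.sum_congr rfl fun k _ => ?_
  rw [intervalIntegral.integral_const_mul]
  congr 1
  have hd : ∀ s ∈ Set.uIcc 0 t, HasDerivAt (fun s => -Real.exp (-(2 * l k) * s))
      (2 * l k * Real.exp (-(2 * l k) * s)) s := by
    intro s _
    have := (((hasDerivAt_id s).const_mul (-(2 * l k))).exp).neg
    convert! this using 1
    simp; ring
  rw [intervalIntegral.integral_eq_sub_of_hasDerivAt hd
    (Continuous.intervalIntegrable (by fun_prop) _ _), ← Real.exp_nat_mul]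
  have e : -(2 * l k) * t = (2 : ℕ) * -(l k * t) := by push_cast; ring
  rw [e]; simp; ring

lemma posDef_conj_diagonal {G : Matrix (Fin r) (Fin r) ℝ} (hG : IsUnit G) {d : Fin r → ℝ}
    (hd : ∀ i, 0 < d i) : (G * diagonal d * Gᵀ).PosDef := by
  have := (PosDef.diagonal hd).mul_mul_conjTranspose_same (B := G)
    (vecMul_injective_iff_isUnit.2 hG)
  rwa [conjTranspose_eq_transpose_of_trivial] at this

lemma posSemidef_conj_diagonal (G : Matrix (Fin r) (Fin r) ℝ) {d : Fin r → ℝ}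
    (hd : ∀ i, 0 ≤ d i) : (G * diagonal d * Gᵀ).PosSemidef := by
  have := (PosSemidef.diagonal (d := d) hd).mul_mul_conjTranspose_same G
  rwa [conjTranspose_eq_transpose_of_trivial] at this

end Gramian

/-! ### Limiting covariance and eigenvector coordinates. -/

section Structure

variable {r : ℕ} {A R S : Matrix (Fin r) (Fin r) ℝ}

/-- The consequences of the form `M = -(C Y C⁻¹)` of the drift matrix. -/
theorem covariance_structure (hR : R.PosDef) (hS : S.PosSemidef)
    (hAS : IsControllable Aᵀ (CFC.sqrt S)) (hrev : A * R = R * Aᵀ) :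
    HasPosEigenvalues (A ^ 2 + R * S) ∧ (∃! X, IsPosSqrt (A ^ 2 + R * S) X) ∧
    posSqrt (A ^ 2 + R * S) = -drift A R S ∧ A ^ 2 + R * S = drift A R S * drift A R S ∧
    (∀ i j, IntegrableOn (fun s => gramIntegrand (drift A R S) R s i j) (Set.Ioi 0)) ∧
    (hCovInf A R S).PosDef ∧ R = -(2 : ℝ) • (drift A R S * hCovInf A R S) := by
  obtain ⟨-, C, Y, hC, hY, hCC, hsq, hM⟩ := riccati_structure hR hS hAS hrev
  obtain ⟨U, hU, y, -, hYU⟩ := exists_orthogonal_diagonal hY.1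
  have hUU := orthogonal_mul_transpose hU
  have hUU' := transpose_mul_orthogonal hU
  have hUdet : IsUnit U.det := isUnit_det_of_right_inverse hUU
  have hUinv : U⁻¹ = Uᵀ := inv_eq_right_inv hUU
  have hCdet := (isUnit_iff_isUnit_det _).1 hC.isUnit
  have hYd : Y = U * diagonal y * Uᵀ := by
    rw [← hYU, mul_assoc, hUU, mul_one]
  have hy : ∀ i, 0 < y i := by
    intro i
    have h1 : Uᵀ * Y * U = diagonal y := by
      rw [mul_assoc, hYU, ← mul_assoc, hUU', one_mul]
    have h2 : (Uᵀ * Y * U).PosDef := by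
      have := hY.conjTranspose_mul_mul_same (B := U)
        (mulVec_injective_iff_isUnit.2 ((isUnit_iff_isUnit_det _).2 hUdet))
      rwa [conjTranspose_eq_transpose_of_trivial] at this
    rw [h1, posDef_diagonal_iff] at h2
    exact h2 i
  -- `U` diagonalizes `Y`, so this `G` gives `M = -G diag(y) G⁻¹` and `R = G G'`; hence `P = G
  -- diag(1/(2y)) G'` and `M P = -R/2`.
  set G := C * U with hGdef
  have hG : IsUnit G := hC.isUnit.mul ((isUnit_iff_isUnit_det _).2 hUdet)
  have hGdet := (isUnit_iff_isUnit_det _).1 hG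
  have hGinv : G⁻¹ = Uᵀ * C⁻¹ := by rw [hGdef, Matrix.mul_inv_rev, hUinv]
  have hGT : Gᵀ = Uᵀ * C := by rw [hGdef, transpose_mul, transpose_eq_of_isHermitian hC.1]
  have hCY : C * Y * C⁻¹ = G * diagonal y * G⁻¹ := by
    rw [hYd, hGinv, hGdef]; simp only [mul_assoc]
  have hMG : drift A R S = -(G * diagonal y * G⁻¹) := by rw [hM, hCY]
  have hRG : R = G * diagonal (fun _ => 1) * Gᵀ := by
    rw [diagonal_one, mul_one, hGT, hGdef, ← hCC, mul_assoc, ← mul_assoc U, hUU, one_mul]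
  have hMM : drift A R S * drift A R S = G * diagonal (fun i => y i ^ 2) * G⁻¹ := by
    rw [hMG, neg_mul_neg]; simp only [mul_assoc]
    rw [nonsing_inv_mul_cancel_left _ _ hGdet, ← mul_assoc (diagonal y), diagonal_mul_diagonal]
    simp only [sq]
  have hsqM : A ^ 2 + R * S = drift A R S * drift A R S := by
    rw [hsq, hM, neg_mul_neg]; simp only [mul_assoc]
    rw [nonsing_inv_mul_cancel_left _ _ hCdet]
  have hX : IsPosSqrt (A ^ 2 + R * S) (G * diagonal y * G⁻¹) := by
    refine ⟨?_, hasPosEigenvalues_conj_diagonal hG hy⟩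
    rw [hsqM, hMG, neg_mul_neg]
  have hXu : ∀ X, IsPosSqrt (A ^ 2 + R * S) X → X = G * diagonal y * G⁻¹ := by
    intro X hX
    rw [hsqM, hMM] at hX
    exact isPosSqrt_conj_diagonal_unique hG hy hX
  have hP : hCovInf A R S = G * diagonal (fun i => 1 / (2 * y i)) * Gᵀ := by
    ext i j
    exact (integrableOn_gramIntegrand hG hy hMG hRG i j).2
  refine ⟨?_, ⟨_, hX, hXu⟩, ?_, hsqM,
    fun i j => (integrableOn_gramIntegrand hG hy hMG hRG i j).1, ?_, ?_⟩
  · rw [hsqM, hMM]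
    exact hasPosEigenvalues_conj_diagonal hG fun i => pow_pos (hy i) 2
  · have h : ∃ X, IsPosSqrt (A ^ 2 + R * S) X := ⟨_, hX⟩
    rw [posSqrt, dif_pos h, hXu _ h.choose_spec, hMG, neg_neg]
  · rw [hP]
    exact posDef_conj_diagonal hG fun i => by have := hy i; positivity
  · rw [hP, hMG, neg_mul, smul_neg, neg_smul, neg_neg]
    simp only [mul_assoc]
    rw [nonsing_inv_mul_cancel_left _ _ hGdet, ← mul_assoc (diagonal y), diagonal_mul_diagonal,
      ← mul_smul_comm, ← smul_mul_assoc, ← diagonal_smul, ← mul_assoc]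
    conv_lhs => rw [hRG]
    congr 3; ext i
    have := (hy i).ne'
    simp; field_simp

/-- From `R = -2 M P` one gets `-Λ = ½ P^(-1/2) R P^(-1/2)`. This symmetry is what provides
orthonormal eigenvectors. -/
lemma LambdaMat_eq (hR : R.PosDef) (hS : S.PosSemidef)
    (hAS : IsControllable Aᵀ (CFC.sqrt S)) (hrev : A * R = R * Aᵀ) :
    LambdaMat A R S = (CFC.sqrt (hCovInf A R S))⁻¹ * drift A R S * CFC.sqrt (hCovInf A R S) ∧
    (-LambdaMat A R S).PosDef := by
  obtain ⟨-, -, hsqrt, -, -, hP, hRP⟩ := covariance_structure hR hS hAS hrev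
  set D := CFC.sqrt (hCovInf A R S)
  have hD : D.PosDef := posDef_sqrt hP
  have hDD : D * D = hCovInf A R S := sqrt_mul_sqrt hP.posSemidef
  have hDdet := (isUnit_iff_isUnit_det _).1 hD.isUnit
  have h1 : LambdaMat A R S = D⁻¹ * drift A R S * D := by
    rw [LambdaMat, hsqrt, mul_neg, neg_mul, neg_neg]
  refine ⟨h1, ?_⟩
  have h2 : -LambdaMat A R S = (1 / 2 : ℝ) • (D⁻¹ * R * D⁻¹) := by
    have : D⁻¹ * R * D⁻¹ = -(2 : ℝ) • (D⁻¹ * drift A R S * D) := by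
      conv_lhs => rw [hRP]
      rw [mul_smul_comm, smul_mul_assoc, ← hDD]
      simp only [← mul_assoc]
      rw [mul_nonsing_inv_cancel_right _ _ hDdet]
    rw [this, h1, smul_smul]; norm_num
  rw [h2]
  have h3 := hR.mul_mul_conjTranspose_same (B := D⁻¹)
    (vecMul_injective_iff_isUnit.2 hD.inv.isUnit)
  rw [hD.inv.1.eq] at h3
  exact h3.smul (by norm_num)

lemma exists_isEigenData (hR : R.PosDef) (hS : S.PosSemidef)
    (hAS : IsControllable Aᵀ (CFC.sqrt S)) (hrev : A * R = R * Aᵀ) :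
    ∃ (Z : Matrix (Fin r) (Fin r) ℝ) (lam : Fin r → ℝ), IsEigenData A R S Z lam := by
  obtain ⟨U, hU, d, hd, h⟩ := exists_orthogonal_diagonal (LambdaMat_eq hR hS hAS hrev).2.1
  refine ⟨U, d, hU, fun i => ?_, hd⟩
  ext j
  have := congrFun (congrFun h j) i
  rw [neg_mul, mul_diagonal, neg_apply, mul_apply] at this
  simp only [mulVec, dotProduct, col_apply, Pi.smul_apply, smul_eq_mul]
  linarith

/-- The coordinates in which the `h`-process is a product of one-dimensional Ornstein-Uhlenbeck
processes. -/
theorem eigenData_structure (hR : R.PosDef) (hS : S.PosSemidef)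
    (hAS : IsControllable Aᵀ (CFC.sqrt S)) (hrev : A * R = R * Aᵀ)
    {Z : Matrix (Fin r) (Fin r) ℝ} {lam : Fin r → ℝ} (hZ : IsEigenData A R S Z lam) :
    (∀ i, 0 < lam i) ∧
    Finset.univ.val.map lam = (A ^ 2 + R * S).charpoly.roots.map Real.sqrt ∧
    ∃ G : Matrix (Fin r) (Fin r) ℝ, IsUnit G ∧ Zᵀ * (CFC.sqrt (hCovInf A R S))⁻¹ = G⁻¹ ∧
      hCovInf A R S = G * Gᵀ ∧
      (∀ t : ℝ, NormedSpace.exp (t • drift A R S)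
        = G * diagonal (fun i => Real.exp (-(lam i * t))) * G⁻¹) ∧
      ∀ t : ℝ≥0, hCov A R S t
        = G * diagonal (fun i => 1 - Real.exp (-(lam i * t)) ^ 2) * Gᵀ := by
  obtain ⟨-, -, -, hsq, -, hP, hRP⟩ := covariance_structure hR hS hAS hrev
  obtain ⟨hLam, hLpos⟩ := LambdaMat_eq hR hS hAS hrev
  set D := CFC.sqrt (hCovInf A R S)
  have hD : D.PosDef := posDef_sqrt hP
  have hDD : D * D = hCovInf A R S := sqrt_mul_sqrt hP.posSemidef
  have hDdet := (isUnit_iff_isUnit_det _).1 hD.isUnit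
  have hZZ := orthogonal_mul_transpose hZ.orthogonal
  have hZZ' := transpose_mul_orthogonal hZ.orthogonal
  have hZdet : IsUnit Z.det := isUnit_det_of_right_inverse hZZ
  have hZinv : Z⁻¹ = Zᵀ := inv_eq_right_inv hZZ
  have hLZ : -LambdaMat A R S * Z = Z * diagonal lam := by
    ext j i
    have := congrFun (hZ.eigen i) j
    rw [neg_mul, mul_diagonal, neg_apply, mul_apply]
    simp only [mulVec, dotProduct, col_apply, Pi.smul_apply, smul_eq_mul] at this
    linarith
  have hlam : ∀ i, 0 < lam i := by
    intro i
    have h1 : Zᵀ * (-LambdaMat A R S) * Z = diagonal lam := by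
      rw [mul_assoc, hLZ, ← mul_assoc, hZZ', one_mul]
    have h2 : (Zᵀ * (-LambdaMat A R S) * Z).PosDef := by
      have := hLpos.conjTranspose_mul_mul_same (B := Z)
        (mulVec_injective_iff_isUnit.2 ((isUnit_iff_isUnit_det _).2 hZdet))
      rwa [conjTranspose_eq_transpose_of_trivial] at this
    rw [h1, posDef_diagonal_iff] at h2
    exact h2 i
  -- With `D = P^(1/2)`, the coordinates `G⁻¹ x` whiten `P` and diagonalize the drift at the same
  -- time.
  set G := D * Z with hGdef
  have hG : IsUnit G := hD.isUnit.mul ((isUnit_iff_isUnit_det _).2 hZdet)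
  have hGdet := (isUnit_iff_isUnit_det _).1 hG
  have hGinv : G⁻¹ = Zᵀ * D⁻¹ := by rw [hGdef, Matrix.mul_inv_rev, hZinv]
  have hGT : Gᵀ = Zᵀ * D := by rw [hGdef, transpose_mul, transpose_eq_of_isHermitian hD.1]
  have hGG : hCovInf A R S = G * Gᵀ := by
    rw [hGT, hGdef, ← hDD, mul_assoc, ← mul_assoc Z, hZZ, one_mul]
  have hM : drift A R S = -(G * diagonal lam * G⁻¹) := by
    have h1 : G * diagonal lam * G⁻¹ = D * (-LambdaMat A R S) * D⁻¹ := by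
      rw [hGinv, hGdef, mul_assoc D, ← hLZ]
      simp only [mul_assoc]
      rw [← mul_assoc Z, hZZ, one_mul]
    rw [h1, hLam, mul_neg, neg_mul, neg_neg]
    simp only [← mul_assoc]
    rw [mul_nonsing_inv _ hDdet, one_mul, mul_nonsing_inv_cancel_right _ _ hDdet]
  have hRG : R = G * diagonal (fun i => 2 * lam i) * Gᵀ := by
    conv_lhs => rw [hRP]
    rw [hGG, hM, neg_mul, smul_neg, neg_smul, neg_neg]
    simp only [mul_assoc]
    rw [nonsing_inv_mul_cancel_left _ _ hGdet, ← mul_smul_comm, ← smul_mul_assoc, ← diagonal_smul]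
    rfl
  refine ⟨hlam, ?_, G, hG, hGinv.symm, hGG, exp_smul_conj_diagonal hG hM, fun t => ?_⟩
  · have hMM : drift A R S * drift A R S = G * diagonal (fun i => lam i ^ 2) * G⁻¹ := by
      rw [hM, neg_mul_neg]; simp only [mul_assoc]
      rw [nonsing_inv_mul_cancel_left _ _ hGdet, ← mul_assoc (diagonal lam), diagonal_mul_diagonal]
      simp only [sq]
    rw [hsq, hMM, roots_charpoly_conj_diagonal hG, Multiset.map_map]
    refine Multiset.map_congr rfl fun i _ => ?_
    simp [Real.sqrt_sq (hlam i).le]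
  · ext i j
    exact integral_gramIntegrand hG hM hRG t i j

end Structure

end HDiffusion

namespace HDiffusion

/-! ### Riemann-Stieltjes sums and variation of constants. -/

section Riemann

open Filter Topology

variable {E : Type*} [NormedAddCommGroup E] [NormedSpace ℝ E]

/-- Riemann sums in which the values at the endpoints of the subdivision may be mixed with the
values at the integration variable. -/
lemma tendsto_sum_integral_subdivision {F : ℝ → ℝ → ℝ → E}
    (hF : Continuous fun p : ℝ × ℝ × ℝ => F p.1 p.2.1 p.2.2) {t : ℝ} (ht : 0 ≤ t) :
    Tendsto (fun n : ℕ => ∑ k ∈ Finset.range n,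
      ∫ s in (k * (t / n))..((k + 1 : ℕ) * (t / n)), F (k * (t / n)) ((k + 1 : ℕ) * (t / n)) s)
      atTop (𝓝 (∫ s in (0 : ℝ)..t, F s s s)) := by
  have hdiag : Continuous fun s => F s s s := hF.comp (by fun_prop : Continuous fun s : ℝ => (s, s, s))
  have huc := (isCompact_Icc (a := ((0 : ℝ), (0 : ℝ), (0 : ℝ)))
    (b := (t, t, t))).uniformContinuousOn_of_continuous hF.continuousOn
  rw [Metric.tendsto_atTop]
  intro ε hε
  -- Dividing by `t + 1` instead of `t` covers `t = 0` and keeps the final inequality strict.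
  obtain ⟨δ, hδ, hδF⟩ := Metric.uniformContinuousOn_iff.1 huc (ε / (t + 1)) (by positivity)
  obtain ⟨N, hN⟩ := exists_nat_gt (t / δ)
  refine ⟨N + 1, fun n hn => ?_⟩
  have hn0 : 0 < (n : ℝ) := by exact_mod_cast (Nat.succ_pos N).trans_le hn
  have hmesh : t / n < δ := by
    have : (N : ℝ) < n := by exact_mod_cast hn
    rw [div_lt_iff₀ hn0]; rw [div_lt_iff₀ hδ] at hN; nlinarith
  have hmesh0 : 0 ≤ t / n := by positivity
  have hend : (n : ℝ) * (t / n) = t := by field_simp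
  have htel : ∫ s in (0 : ℝ)..t, F s s s = ∑ k ∈ Finset.range n,
      ∫ s in (k * (t / n))..((k + 1 : ℕ) * (t / n)), F s s s := by
    rw [intervalIntegral.sum_integral_adjacent_intervals (a := fun k : ℕ => (k : ℝ) * (t / n))
      fun k _ => hdiag.intervalIntegrable _ _]
    simp [hend]
  rw [htel, dist_eq_norm, ← Finset.sum_sub_distrib]
  have hterm : ∀ k ∈ Finset.range n,
      ‖(∫ s in (k * (t / n))..((k + 1 : ℕ) * (t / n)), F (k * (t / n)) ((k + 1 : ℕ) * (t / n)) s)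
        - ∫ s in (k * (t / n))..((k + 1 : ℕ) * (t / n)), F s s s‖ ≤ ε / (t + 1) * (t / n) := by
    intro k hk
    set a : ℝ := k * (t / n) with ha
    set b : ℝ := (k + 1 : ℕ) * (t / n) with hb
    have hba : b - a = t / n := by rw [ha, hb]; push_cast; ring
    have ha0 : 0 ≤ a := by positivity
    have hbt : b ≤ t := by
      rw [← hend, hb]
      exact mul_le_mul_of_nonneg_right (by exact_mod_cast Finset.mem_range.1 hk) hmesh0
    have hab : a ≤ b := by linarith
    have hc : Continuous fun s => F a b s :=
      hF.comp (by fun_prop : Continuous fun s : ℝ => (a, b, s))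
    rw [← intervalIntegral.integral_sub (hc.intervalIntegrable _ _) (hdiag.intervalIntegrable _ _)]
    refine (intervalIntegral.norm_integral_le_of_norm_le_const (C := ε / (t + 1))
      fun s hs => ?_).trans (by rw [hba, abs_of_nonneg hmesh0])
    rw [Set.uIoc_of_le hab] at hs
    rw [← dist_eq_norm]
    refine (hδF (a, b, s) ?_ (s, s, s) ?_ ?_).le
    · exact ⟨⟨ha0, by linarith, by simpa using by linarith [hs.1]⟩,
        ⟨by simpa using by linarith, hbt, by simpa using by linarith [hs.2]⟩⟩
    · have h1 : 0 ≤ s := by linarith [hs.1]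
      have h2 : s ≤ t := by linarith [hs.2]
      exact ⟨⟨h1, h1, h1⟩, ⟨h2, h2, h2⟩⟩
    · have h1 : |a - s| < δ := by rw [abs_lt]; constructor <;> linarith [hs.1, hs.2]
      have h2 : |b - s| < δ := by rw [abs_lt]; constructor <;> linarith [hs.1, hs.2]
      simp [Prod.dist_eq, Real.dist_eq, h1, h2]
  calc _ ≤ ∑ k ∈ Finset.range n, ε / (t + 1) * (t / n) := norm_sum_le_of_le _ hterm
    _ = ε * (t / (t + 1)) := by
      rw [Finset.sum_const, Finset.card_range, nsmul_eq_mul]; field_simp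
    _ < ε * 1 := by
      refine mul_lt_mul_of_pos_left ?_ hε
      rw [div_lt_one (by linarith)]; linarith
    _ = ε := mul_one ε

variable [CompleteSpace E]

lemma hasDerivAt_exp_sub_smul_apply (L : E →L[ℝ] E) (t : ℝ) (y : E) (s : ℝ) :
    HasDerivAt (fun s => NormedSpace.exp ((t - s) • L) y)
      (-(NormedSpace.exp ((t - s) • L) (L y))) s := by
  have h := (hasDerivAt_exp_smul_const (𝕂 := ℝ) L (t - s)).scomp s ((hasDerivAt_id s).const_sub t)
  have h2 := ((ContinuousLinearMap.apply ℝ E y).hasFDerivAt.comp_hasDerivAt s h)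
  convert! h2 using 1
  simp

lemma continuous_exp_sub_smul (L : E →L[ℝ] E) (t : ℝ) :
    Continuous fun s : ℝ => NormedSpace.exp ((t - s) • L) :=
  (continuous_iff_continuousAt.2 fun u =>
    (hasDerivAt_exp_smul_const (𝕂 := ℝ) L u).continuousAt).comp (by fun_prop)

/-- The variation of constants formula for a linear equation driven by a continuous path, as a
limit of Riemann-Stieltjes sums. -/
lemma tendsto_riemann_stieltjes {L : E →L[ℝ] E} {X w : ℝ → E} {x : E} {t : ℝ} (ht : 0 ≤ t)
    (hX : Continuous X) (hX0 : X 0 = x)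
    (h : ∀ s, 0 ≤ s → X s = x + (∫ u in (0 : ℝ)..s, L (X u)) + w s) :
    Tendsto (fun n : ℕ => NormedSpace.exp (t • L) x + ∑ k ∈ Finset.range n,
      NormedSpace.exp ((t - k * (t / n)) • L) (w ((k + 1 : ℕ) * (t / n)) - w (k * (t / n))))
      atTop (𝓝 (X t)) := by
  have hΦ := continuous_exp_sub_smul L t
  have hLX : Continuous fun s => L (X s) := L.continuous.comp hX
  -- On a cell `[a, b]`, the Stieltjes term `e^{(t-a)L}(w_b - w_a)` differs from the increment of
  -- `e^{(t-s)L} X_s` by the integral of `e^{(t-s)L} L X_b - e^{(t-a)L} L X_s`. This integrand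
  -- vanishes for `a = b = s`, so the total error tends to 0, while the increments telescope.
  have hF : Continuous fun p : ℝ × ℝ × ℝ =>
      NormedSpace.exp ((t - p.2.2) • L) (L (X p.2.1))
        - NormedSpace.exp ((t - p.1) • L) (L (X p.2.2)) := by
    refine Continuous.sub ?_ ?_
    · exact (hΦ.comp (by fun_prop : Continuous fun p : ℝ × ℝ × ℝ => p.2.2)).clm_apply
        (hLX.comp (by fun_prop : Continuous fun p : ℝ × ℝ × ℝ => p.2.1))
    · exact (hΦ.comp (by fun_prop : Continuous fun p : ℝ × ℝ × ℝ => p.1)).clm_apply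
        (hLX.comp (by fun_prop : Continuous fun p : ℝ × ℝ × ℝ => p.2.2))
  have hlim := tendsto_sum_integral_subdivision (F := fun a b s =>
      NormedSpace.exp ((t - s) • L) (L (X b)) - NormedSpace.exp ((t - a) • L) (L (X s))) hF ht
  simp only [sub_self, intervalIntegral.integral_zero] at hlim
  have hlim2 := hlim.const_add (X t)
  rw [add_zero] at hlim2
  refine hlim2.congr' ?_
  filter_upwards [eventually_gt_atTop 0] with n hn
  have hn0 : 0 < (n : ℝ) := by exact_mod_cast hn
  have hend : (n : ℝ) * (t / n) = t := by field_simp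
  have hterm : ∀ k ∈ Finset.range n,
      ∫ s in (k * (t / n))..((k + 1 : ℕ) * (t / n)),
        (NormedSpace.exp ((t - s) • L) (L (X ((k + 1 : ℕ) * (t / n))))
          - NormedSpace.exp ((t - k * (t / n)) • L) (L (X s)))
      = NormedSpace.exp ((t - k * (t / n)) • L) (w ((k + 1 : ℕ) * (t / n)) - w (k * (t / n)))
        - (NormedSpace.exp ((t - (k + 1 : ℕ) * (t / n)) • L) (X ((k + 1 : ℕ) * (t / n)))
          - NormedSpace.exp ((t - k * (t / n)) • L) (X (k * (t / n)))) := by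
    intro k _
    have ha0 : 0 ≤ (k : ℝ) * (t / n) := by positivity
    have hb0 : 0 ≤ ((k + 1 : ℕ) : ℝ) * (t / n) := by positivity
    generalize (k : ℝ) * (t / n) = a at *
    generalize ((k + 1 : ℕ) : ℝ) * (t / n) = b at *
    have hw : w b - w a = X b - X a - ∫ u in a..b, L (X u) := by
      have e1 : w b = X b - x - ∫ u in (0 : ℝ)..b, L (X u) := by rw [h b hb0]; abel
      have e2 : w a = X a - x - ∫ u in (0 : ℝ)..a, L (X u) := by rw [h a ha0]; abel
      rw [e1, e2, ← intervalIntegral.integral_interval_sub_left (hLX.intervalIntegrable 0 b)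
        (hLX.intervalIntegrable 0 a)]
      abel
    have h1 : ∫ s in a..b, NormedSpace.exp ((t - s) • L) (L (X b))
        = NormedSpace.exp ((t - a) • L) (X b) - NormedSpace.exp ((t - b) • L) (X b) := by
      have := intervalIntegral.integral_eq_sub_of_hasDerivAt (a := a) (b := b)
        (fun s _ => (hasDerivAt_exp_sub_smul_apply L t (X b) s).neg)
        ((by simpa using hΦ.clm_apply continuous_const : Continuous _).intervalIntegrable _ _)
      simp only [neg_neg] at this
      rw [this]; simp only [Pi.neg_apply]; abel
    have h2 : ∫ s in a..b, NormedSpace.exp ((t - a) • L) (L (X s))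
        = NormedSpace.exp ((t - a) • L) (∫ s in a..b, L (X s)) :=
      ContinuousLinearMap.intervalIntegral_comp_comm _ (hLX.intervalIntegrable _ _)
    rw [intervalIntegral.integral_sub ((hΦ.clm_apply continuous_const).intervalIntegrable _ _)
      ((continuous_const.clm_apply hLX).intervalIntegrable _ _), h1, h2, hw]
    simp only [map_sub]
    abel
  rw [Finset.sum_congr rfl hterm, Finset.sum_sub_distrib,
    Finset.sum_range_sub (fun k : ℕ => NormedSpace.exp ((t - k * (t / n)) • L) (X (k * (t / n))))]
  simp only [hend, sub_self, zero_smul, NormedSpace.exp_zero, one_apply_eq_self,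
    Nat.cast_zero, zero_mul, sub_zero, hX0]
  abel

end Riemann

end HDiffusion

namespace HDiffusion

/-! ### Characteristic functions of Brownian increments. -/

section Brownian

variable {Ω : Type*} [MeasurableSpace Ω] {P : Measure Ω}

/-- Increments along a monotone subdivision are independent centred Gaussians with variance the time
step, so the expectation factors. -/
lemma integral_cexp_sum_increments [IsProbabilityMeasure P] {W : ℝ≥0 → Ω → ℝ}
    (hW : IsBrownianReal W P) (c : ℕ → ℝ) {τ : ℕ → ℝ≥0} (hτ : Monotone τ) (n : ℕ) :
    ∫ ω, Complex.exp ((∑ k ∈ Finset.range n, c k * (W (τ (k + 1)) ω - W (τ k) ω) : ℝ) * Complex.I) ∂P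
      = Complex.exp ((-(∑ k ∈ Finset.range n, c k ^ 2 * ((τ (k + 1) : ℝ) - τ k)) / 2 : ℝ)) := by
  have hm : ∀ k, AEMeasurable (fun ω => W (τ (k + 1)) ω - W (τ k) ω) P := fun k =>
    (hW.aemeasurable _).sub (hW.aemeasurable _)
  have hind : iIndepFun (fun (k : Fin n) ω => W (τ (k + 1)) ω - W (τ k) ω) P :=
    (hW.hasIndepIncrements.nat hτ).precomp Fin.val_injective
  have h1 := hind.integral_fun_prod_comp (fun k => hm k)
    (f := fun (k : Fin n) x => Complex.exp ((c k * x : ℝ) * Complex.I))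
    (fun k => Measurable.aestronglyMeasurable (by fun_prop))
  have e1 : ∀ ω, Complex.exp ((∑ k ∈ Finset.range n, c k * (W (τ (k + 1)) ω - W (τ k) ω) : ℝ)
        * Complex.I)
      = ∏ k : Fin n, Complex.exp ((c k * (W (τ (k + 1)) ω - W (τ k) ω) : ℝ) * Complex.I) := by
    intro ω
    rw [← Complex.exp_sum, Finset.sum_range, Complex.ofReal_sum, Finset.sum_mul]
  simp_rw [e1]
  rw [h1, Finset.sum_range, neg_div, Finset.sum_div, ← Finset.sum_neg_distrib, Complex.ofReal_sum,
    Complex.exp_sum]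
  refine Finset.prod_congr rfl fun k _ => ?_
  have hlaw := hW.hasLaw_sub (τ (k + 1)) (τ k)
  have h2 : ∫ ω, Complex.exp ((c k * (W (τ (k + 1)) ω - W (τ k) ω) : ℝ) * Complex.I) ∂P
      = charFun (gaussianReal 0 (nndist (τ (k + 1)).1 (τ k).1)) (c k) := by
    rw [charFun_apply_real, ← hlaw.map_eq, integral_map hlaw.aemeasurable
      (Measurable.aestronglyMeasurable (by fun_prop))]
    simp
  rw [h2, charFun_gaussianReal]
  congr 1
  have h3 : ((nndist (τ (k + 1)).1 (τ k).1 : ℝ≥0) : ℝ) = (τ (k + 1) : ℝ) - τ k := by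
    rw [coe_nndist, Real.dist_eq, abs_of_nonneg]
    · rfl
    · exact sub_nonneg.2 (by exact_mod_cast hτ (Nat.le_succ k))
  rw [← h3]
  push_cast
  ring

lemma integral_cexp_sum_sum_increments [IsProbabilityMeasure P] {d : ℕ}
    {W : Fin d → ℝ≥0 → Ω → ℝ} (hW : IsBrownianVector W P) (c : Fin d → ℕ → ℝ) {τ : ℕ → ℝ≥0}
    (hτ : Monotone τ) (n : ℕ) :
    ∫ ω, Complex.exp ((∑ j, ∑ k ∈ Finset.range n,
        c j k * (W j (τ (k + 1)) ω - W j (τ k) ω) : ℝ) * Complex.I) ∂P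
      = Complex.exp
          ((-(∑ j, ∑ k ∈ Finset.range n, c j k ^ 2 * ((τ (k + 1) : ℝ) - τ k)) / 2 : ℝ)) := by
  have hind : iIndepFun (fun j ω => ∑ k ∈ Finset.range n,
      c j k * (W j (τ (k + 1)) ω - W j (τ k) ω)) P :=
    hW.2.comp (fun j (w : ℝ≥0 → ℝ) => ∑ k ∈ Finset.range n, c j k * (w (τ (k + 1)) - w (τ k)))
      fun j => by fun_prop
  have hm : ∀ j, AEMeasurable (fun ω => ∑ k ∈ Finset.range n,
      c j k * (W j (τ (k + 1)) ω - W j (τ k) ω)) P := fun j =>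
    Finset.aemeasurable_fun_sum _ fun k _ =>
      (((hW.1 j).aemeasurable _).sub ((hW.1 j).aemeasurable _)).const_mul _
  have h1 := hind.integral_fun_prod_comp hm
    (f := fun _ x => Complex.exp ((x : ℝ) * Complex.I))
    (fun k => Measurable.aestronglyMeasurable (by fun_prop))
  simp_rw [Complex.ofReal_sum Finset.univ, Finset.sum_mul, Complex.exp_sum]
  rw [h1, neg_div, Finset.sum_div, ← Finset.sum_neg_distrib, Complex.ofReal_sum, Complex.exp_sum]
  refine Finset.prod_congr rfl fun j _ => ?_
  rw [integral_cexp_sum_increments (hW.1 j) (c j) hτ n, neg_div]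

end Brownian

/-! ### The law of a linear diffusion. -/

section LinearDiffusion

open Filter Topology
open scoped RealInnerProductSpace

variable {r d : ℕ}

lemma act_eq_toEuclideanCLM (M : Matrix (Fin r) (Fin r) ℝ) (x : State r) :
    act M x = toEuclideanCLM (𝕜 := ℝ) M x := rfl

lemma continuous_toEuclideanCLM_symm :
    Continuous (toEuclideanCLM (n := Fin r) (𝕜 := ℝ)).symm :=
  LinearMap.continuous_of_finiteDimensional
    ({ toFun := (toEuclideanCLM (n := Fin r) (𝕜 := ℝ)).symm
       map_add' := map_add _
       map_smul' := map_smul _ } : (State r →L[ℝ] State r) →ₗ[ℝ] Matrix (Fin r) (Fin r) ℝ)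

lemma toEuclideanCLM_exp (M : Matrix (Fin r) (Fin r) ℝ) :
    toEuclideanCLM (𝕜 := ℝ) (NormedSpace.exp M)
      = NormedSpace.exp (toEuclideanCLM (𝕜 := ℝ) M : State r →L[ℝ] State r) := by
  set f := (toEuclideanCLM (n := Fin r) (𝕜 := ℝ)).symm
  have hf : Continuous f := continuous_toEuclideanCLM_symm
  have h1 := (NormedSpace.exp_series_hasSum_exp' (𝕂 := ℝ)
    (toEuclideanCLM (𝕜 := ℝ) M : State r →L[ℝ] State r)).map f hf
  have h2 : NormedSpace.exp M = f (NormedSpace.exp (toEuclideanCLM (𝕜 := ℝ) M)) := by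
    rw [NormedSpace.exp_eq_tsum ℝ, ← h1.tsum_eq]
    refine tsum_congr fun n => ?_
    simp [f]
  rw [h2]
  simp [f]

lemma continuous_exp_smul (M : Matrix (Fin r) (Fin r) ℝ) :
    Continuous fun s : ℝ => NormedSpace.exp (s • M) := by
  set f := (toEuclideanCLM (n := Fin r) (𝕜 := ℝ)).symm
  have hf : Continuous f := continuous_toEuclideanCLM_symm
  have h : ∀ s : ℝ, NormedSpace.exp (s • M)
      = f (NormedSpace.exp (s • (toEuclideanCLM (𝕜 := ℝ) M : State r →L[ℝ] State r))) := by
    intro s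
    rw [← map_smul, ← toEuclideanCLM_exp]
    simp [f]
  simp_rw [h]
  have h2 := (continuous_exp_sub_smul
    (toEuclideanCLM (𝕜 := ℝ) M : State r →L[ℝ] State r) 0).comp continuous_neg
  simp only [Function.comp_def, zero_sub, neg_neg] at h2
  exact hf.comp h2

lemma continuous_gramIntegrand (M R : Matrix (Fin r) (Fin r) ℝ) :
    Continuous (gramIntegrand M R) := by
  unfold gramIntegrand
  exact ((continuous_exp_smul M).matrix_mul continuous_const).matrix_mul (continuous_exp_smul Mᵀ)

lemma act_toLp_eq_sum (B : Matrix (Fin r) (Fin d) ℝ) (f : Fin d → ℝ) :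
    act B (WithLp.toLp 2 f) = ∑ j, f j • (WithLp.toLp 2 (B.col j) : State r) := by
  ext i
  simp [act, mulVec, dotProduct, mul_comm]

/-- The left side is the variance rate of the noise in the direction `u`; through `B B' = R` it
depends on `B` only via `R`. -/
lemma sum_sq_inner_exp (M R : Matrix (Fin r) (Fin r) ℝ) {B : Matrix (Fin r) (Fin d) ℝ}
    (hB : B * Bᵀ = R) (s : ℝ) (u : State r) :
    ∑ j, ⟪act (NormedSpace.exp (s • M)) (WithLp.toLp 2 (B.col j)), u⟫ ^ 2
      = WithLp.ofLp u ⬝ᵥ gramIntegrand M R s *ᵥ WithLp.ofLp u := by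
  have h : gramIntegrand M R s
      = (NormedSpace.exp (s • M) * B) * (NormedSpace.exp (s • M) * B)ᵀ := by
    rw [gramIntegrand, ← hB, transpose_mul, ← exp_transpose, transpose_smul]
    simp only [Matrix.mul_assoc]
  rw [h, ← mulVec_mulVec, dotProduct_mulVec, ← mulVec_transpose]
  simp only [dotProduct, ← sq]
  refine Finset.sum_congr rfl fun j _ => ?_
  congr 1
  simp only [act, PiLp.inner_apply, RCLike.inner_apply, conj_trivial, mulVec, dotProduct, mul_apply,
    transpose_apply, col_apply]
  exact Finset.sum_congr rfl fun i _ => mul_comm _ _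

/-- The law at time `t` of a linear diffusion started from a point. -/
theorem hasLaw_linearDiffusion {Ω : Type*} [MeasurableSpace Ω] {P : Measure Ω}
    [IsProbabilityMeasure P] {M R C : Matrix (Fin r) (Fin r) ℝ} {B : Matrix (Fin r) (Fin d) ℝ}
    {x : State r} {W : Fin d → ℝ≥0 → Ω → ℝ} {X : ℝ≥0 → Ω → State r} (hB : B * Bᵀ = R)
    (hW : IsBrownianVector W P) (hX : IsLinearDiffusion M B x W X P) (t : ℝ≥0)
    (hC : C = Matrix.of fun i j => ∫ s in (0 : ℝ)..(t : ℝ), gramIntegrand M R s i j)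
    (hCpos : C.PosSemidef) :
    HasLaw (X t) (multivariateGaussian (act (NormedSpace.exp ((t : ℝ) • M)) x) C) P := by
  set L : State r →L[ℝ] State r := toEuclideanCLM (𝕜 := ℝ) M with hL
  have hexp : ∀ (s : ℝ) (y : State r), NormedSpace.exp (s • L) y = act (NormedSpace.exp (s • M)) y := by
    intro s y
    rw [act_eq_toEuclideanCLM, toEuclideanCLM_exp, map_smul]
  let w : ℝ≥0 → Ω → State r := fun s ω => act B (WithLp.toLp 2 fun j => W j s ω)
  let τ : ℕ → ℕ → ℝ≥0 := fun n k => k * (t / n)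
  have hτc : ∀ n k, ((τ n k : ℝ≥0) : ℝ) = k * ((t : ℝ) / n) := by
    intro n k; simp [τ]
  have hτm : ∀ n, Monotone (τ n) := by
    intro n a b hab
    exact mul_le_mul_left (by exact_mod_cast hab) _
  -- These approximations are affine in finitely many Brownian increments and converge almost surely
  -- to `X t`, which also yields the measurability of `X t`.
  let Y : ℕ → Ω → State r := fun n ω => NormedSpace.exp ((t : ℝ) • L) x
    + ∑ k ∈ Finset.range n,
        NormedSpace.exp (((t : ℝ) - τ n k) • L) (w (τ n (k + 1)) ω - w (τ n k) ω)
  have hwm : ∀ s, AEMeasurable (w s) P := by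
    intro s
    simp only [w, act_toLp_eq_sum]
    exact Finset.aemeasurable_fun_sum _ fun j _ => ((hW.1 j).aemeasurable s).smul_const _
  have hYm : ∀ n, AEMeasurable (Y n) P := fun n =>
    (Finset.aemeasurable_fun_sum _ fun k _ =>
      (NormedSpace.exp (((t : ℝ) - τ n k) • L)).continuous.measurable.comp_aemeasurable
        ((hwm _).sub (hwm _))).const_add _
  have hlim : ∀ᵐ ω ∂P, Tendsto (fun n => Y n ω) atTop (𝓝 (X t ω)) := by
    have h0 : ∀ᵐ ω ∂P, ∀ j, W j 0 ω = 0 := ae_all_iff.2 fun j => (hW.1 j).eval_zero_ae_eq_zero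
    filter_upwards [hX, h0] with ω hω hω0
    have hw0 : w 0 ω = 0 := by
      simp [w, act_toLp_eq_sum, hω0]
    have h := tendsto_riemann_stieltjes (L := L) (X := fun s => X s.toNNReal ω)
      (w := fun s => w s.toNNReal ω) (x := x) (t := t) t.coe_nonneg
      (hω.1.comp continuous_real_toNNReal) (by
        have := hω.2 0
        simp only [NNReal.coe_zero, intervalIntegral.integral_same, add_zero] at this
        simp only [Real.toNNReal_zero]
        rw [this]
        change x + w 0 ω = x
        rw [hw0, add_zero])
      (fun s hs => by
        have := hω.2 s.toNNReal
        rw [Real.coe_toNNReal s hs] at this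
        exact this)
    simp only [Real.toNNReal_coe] at h
    refine h.congr fun n => ?_
    simp only [Y, ← hτc, Real.toNNReal_coe]
  have hXm : AEMeasurable (X t) P := aemeasurable_of_tendsto_metrizable_ae _ hYm hlim
  have : IsProbabilityMeasure (P.map (X t)) := Measure.isProbabilityMeasure_map hXm
  refine ⟨hXm, Measure.ext_of_charFun (funext fun u => ?_)⟩
  rw [charFun_multivariateGaussian hCpos, charFun_apply,
    integral_map hXm (Measurable.aestronglyMeasurable (by fun_prop))]
  have hconv : Tendsto (fun n => ∫ ω, Complex.exp (⟪Y n ω, u⟫ * Complex.I) ∂P) atTop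
      (𝓝 (∫ ω, Complex.exp (⟪X t ω, u⟫ * Complex.I) ∂P)) := by
    refine tendsto_integral_of_dominated_convergence (fun _ => 1) (fun n => ?_)
      (integrable_const 1) (fun n => ae_of_all _ fun ω => ?_) ?_
    · exact (Measurable.comp_aemeasurable (g := fun y : State r => Complex.exp (⟪y, u⟫ * Complex.I))
        (by fun_prop) (hYm n)).aestronglyMeasurable
    · rw [Complex.norm_exp_ofReal_mul_I]
    · filter_upwards [hlim] with ω hω
      have hc : Continuous fun y : State r => Complex.exp (⟪y, u⟫ * Complex.I) := by fun_prop
      exact (hc.tendsto _).comp hω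
  let c : ℝ → Fin d → ℝ := fun s j =>
    ⟪NormedSpace.exp (((t : ℝ) - s) • L) (WithLp.toLp 2 (B.col j)), u⟫
  have hYu : ∀ n ω, ⟪Y n ω, u⟫ = ⟪NormedSpace.exp ((t : ℝ) • L) x, u⟫
      + ∑ j, ∑ k ∈ Finset.range n, c (τ n k) j * (W j (τ n (k + 1)) ω - W j (τ n k) ω) := by
    intro n ω
    simp only [Y]
    rw [inner_add_left, sum_inner, Finset.sum_comm]
    congr 1
    refine Finset.sum_congr rfl fun k _ => ?_
    simp only [w, act_toLp_eq_sum]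
    rw [← Finset.sum_sub_distrib, map_sum, sum_inner]
    refine Finset.sum_congr rfl fun j _ => ?_
    rw [← sub_smul, map_smul, real_inner_smul_left, mul_comm]
  -- Each variance term is written as the integral of a constant over its cell, so that the limit is
  -- again given by `tendsto_sum_integral_subdivision`.
  have hval : ∀ n, ∫ ω, Complex.exp (⟪Y n ω, u⟫ * Complex.I) ∂P
      = Complex.exp (⟪NormedSpace.exp ((t : ℝ) • L) x, u⟫ * Complex.I) *
        Complex.exp ((-(∑ k ∈ Finset.range n, ∫ _ in (k * ((t : ℝ) / n))..((k + 1 : ℕ) * ((t : ℝ) / n)),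
          ∑ j, c (k * ((t : ℝ) / n)) j ^ 2) / 2 : ℝ)) := by
    intro n
    simp_rw [hYu, Complex.ofReal_add, add_mul, Complex.exp_add]
    rw [integral_const_mul, integral_cexp_sum_sum_increments hW (fun j k => c (τ n k) j) (hτm n) n,
      Finset.sum_comm]
    congr 5
    refine Finset.sum_congr rfl fun k _ => ?_
    rw [intervalIntegral.integral_const, smul_eq_mul, Finset.mul_sum]
    refine Finset.sum_congr rfl fun j _ => ?_
    rw [hτc, hτc, mul_comm]
  have hcc : Continuous fun s => ∑ j, c s j ^ 2 := by
    refine continuous_finsetSum _ fun j _ => Continuous.pow ?_ 2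
    exact ((continuous_exp_sub_smul L t).clm_apply continuous_const).inner continuous_const
  have hriem := tendsto_sum_integral_subdivision (F := fun a _ _ => ∑ j, c a j ^ 2)
    (hcc.comp continuous_fst) t.coe_nonneg
  have hint : ∫ s in (0 : ℝ)..t, ∑ j, c s j ^ 2 = WithLp.ofLp u ⬝ᵥ C *ᵥ WithLp.ofLp u := by
    have e1 : ∀ s, ∑ j, c s j ^ 2
        = WithLp.ofLp u ⬝ᵥ gramIntegrand M R ((t : ℝ) - s) *ᵥ WithLp.ofLp u := by
      intro s
      simp only [c, hexp]
      exact sum_sq_inner_exp M R hB _ u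
    simp_rw [e1]
    -- The noise at time `s` is propagated during `t - s`; reversing time gives the Gramian.
    rw [intervalIntegral.integral_comp_sub_left
      (fun s => WithLp.ofLp u ⬝ᵥ gramIntegrand M R s *ᵥ WithLp.ofLp u) (t : ℝ), sub_self, sub_zero]
    have hg : ∀ i j, Continuous fun s => gramIntegrand M R s i j := fun i j =>
      (continuous_gramIntegrand M R).matrix_elem i j
    have e2 : ∀ G : Matrix (Fin r) (Fin r) ℝ, WithLp.ofLp u ⬝ᵥ G *ᵥ WithLp.ofLp u
        = ∑ i, ∑ j, u i * u j * G i j := by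
      intro G
      simp only [dotProduct, mulVec, Finset.mul_sum]
      exact Finset.sum_congr rfl fun i _ => Finset.sum_congr rfl fun j _ => by ring
    simp_rw [e2]
    have hi : ∀ i j, IntervalIntegrable (fun s => u i * u j * gramIntegrand M R s i j) volume 0 t :=
      fun i j => ((hg i j).intervalIntegrable _ _).const_mul _
    have hi2 : ∀ i, IntervalIntegrable (fun s => ∑ j, u i * u j * gramIntegrand M R s i j)
        volume 0 t := fun i => by
      have := IntervalIntegrable.sum Finset.univ fun j _ => hi i j
      simpa only [Finset.sum_fn] using this
    rw [intervalIntegral.integral_finsetSum fun i _ => hi2 i]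
    refine Finset.sum_congr rfl fun i _ => ?_
    rw [intervalIntegral.integral_finsetSum fun j _ => hi i j]
    refine Finset.sum_congr rfl fun j _ => ?_
    rw [intervalIntegral.integral_const_mul, hC, of_apply]
  rw [hint] at hriem
  have hconv2 : Tendsto (fun n => ∫ ω, Complex.exp (⟪Y n ω, u⟫ * Complex.I) ∂P) atTop
      (𝓝 (Complex.exp (⟪NormedSpace.exp ((t : ℝ) • L) x, u⟫ * Complex.I) *
        Complex.exp ((-(WithLp.ofLp u ⬝ᵥ C *ᵥ WithLp.ofLp u) / 2 : ℝ)))) := by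
    simp_rw [hval]
    refine Tendsto.const_mul _ ?_
    have hc : Continuous fun y : ℝ => Complex.exp ((-y / 2 : ℝ)) := by fun_prop
    exact (hc.tendsto _).comp hriem
  rw [tendsto_nhds_unique hconv hconv2, hexp, ← Complex.exp_add, real_inner_comm]
  congr 1
  push_cast
  ring

end LinearDiffusion

end HDiffusion

namespace HDiffusion

/-! ### Spectral expansion of kernels with square integrable densities. -/

section SpectralKernel

open Filter Topology
open scoped RealInnerProductSpace

variable {E ι : Type*} [MeasurableSpace E] {η : Measure E}

lemma Lp_inner_eq_integral {u v : Lp ℝ 2 η} {f g : E → ℝ} (hf : u =ᵐ[η] f) (hg : v =ᵐ[η] g) :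
    ⟪u, v⟫ = ∫ y, f y * g y ∂η := by
  rw [L2.inner_def]
  refine integral_congr_ae ?_
  filter_upwards [hf, hg] with y h1 h2
  rw [h1, h2]
  simp [mul_comm]

/-- A complete orthonormal system of functions gives a Hilbert basis of the `L²` space. -/
lemma exists_hilbertBasis_of_complete [DecidableEq ι] {φ : ι → E → ℝ}
    (hφ : ∀ n, MemLp (φ n) 2 η)
    (horth : ∀ n m, ∫ y, φ n y * φ m y ∂η = if n = m then 1 else 0)
    (hcomp : ∀ g : E → ℝ, MemLp g 2 η → (∀ n, ∫ y, φ n y * g y ∂η = 0) → g =ᵐ[η] 0) :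
    ∃ b : HilbertBasis ι ℝ (Lp ℝ 2 η), ∀ n, b n =ᵐ[η] φ n := by
  have hv : Orthonormal ℝ fun n => (hφ n).toLp (φ n) := by
    rw [orthonormal_iff_ite]
    intro n m
    rw [Lp_inner_eq_integral (hφ n).coeFn_toLp (hφ m).coeFn_toLp, horth]
  refine ⟨HilbertBasis.mkOfOrthogonalEqBot hv ?_, fun n => ?_⟩
  · rw [Submodule.eq_bot_iff]
    intro g hg
    rw [Submodule.mem_orthogonal] at hg
    refine (Lp.eq_zero_iff_ae_eq_zero).2 (hcomp g (Lp.memLp g) fun n => ?_)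
    rw [← Lp_inner_eq_integral (hφ n).coeFn_toLp (ae_eq_refl g)]
    exact hg _ (Submodule.subset_span ⟨n, rfl⟩)
  · rw [HilbertBasis.coe_mkOfOrthogonalEqBot]
    exact (hφ n).coeFn_toLp

variable {φ : ι → E → ℝ} {b : HilbertBasis ι ℝ (Lp ℝ 2 η)}

lemma hasSum_toLp_of_hilbertBasis (hb : ∀ n, b n =ᵐ[η] φ n) {f : E → ℝ} (hf : MemLp f 2 η) :
    HasSum (fun n => (∫ y, φ n y * f y ∂η) • b n) (hf.toLp f) := by
  have h := b.hasSum_repr (hf.toLp f)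
  refine h.congr_fun fun n => ?_
  rw [b.repr_apply_apply, Lp_inner_eq_integral (hb n) hf.coeFn_toLp]

lemma integral_withDensity_ofReal {k : E → ℝ} (hk : AEMeasurable k η) (hk0 : 0 ≤ᵐ[η] k)
    (f : E → ℝ) :
    ∫ y, f y ∂η.withDensity (fun y => ENNReal.ofReal (k y)) = ∫ y, k y * f y ∂η := by
  rw [integral_withDensity_eq_integral_toReal_smul₀ hk.ennreal_ofReal
    (ae_of_all _ fun _ => ENNReal.ofReal_lt_top)]
  refine integral_congr_ae ?_
  filter_upwards [hk0] with y hy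
  rw [ENNReal.toReal_ofReal hy, smul_eq_mul]

lemma integrable_withDensity_ofReal {k f : E → ℝ} (hk : MemLp k 2 η) (hk0 : 0 ≤ᵐ[η] k)
    (hf : MemLp f 2 η) :
    Integrable f (η.withDensity fun y => ENNReal.ofReal (k y)) := by
  rw [integrable_withDensity_iff_integrable_smul₀' hk.aestronglyMeasurable.aemeasurable.ennreal_ofReal
    (ae_of_all _ fun _ => ENNReal.ofReal_lt_top)]
  refine (hk.integrable_mul hf).congr ?_
  filter_upwards [hk0] with y hy
  rw [ENNReal.toReal_ofReal hy, smul_eq_mul, Pi.mul_apply]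

/-- The spectral expansion of a density with given spectral coefficients. -/
lemma hasSum_density (hb : ∀ n, b n =ᵐ[η] φ n) {k : E → ℝ} (hk : MemLp k 2 η)
    (hk0 : 0 ≤ᵐ[η] k) {c : ι → ℝ}
    (hc : ∀ n, ∫ y, φ n y ∂η.withDensity (fun y => ENNReal.ofReal (k y)) = c n) :
    HasSum (fun n => c n • b n) (hk.toLp k) := by
  convert! hasSum_toLp_of_hilbertBasis hb hk using 3 with n
  rw [← hc, integral_withDensity_ofReal hk.aestronglyMeasurable.aemeasurable hk0]
  simp_rw [mul_comm]

/-- A function which is pointwise the sum of an orthogonal series is its sum in `L²`. -/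
lemma ae_eq_of_hasSum_of_hasSum [Countable ι] (hb : ∀ n, b n =ᵐ[η] φ n) {c : ι → ℝ}
    {g : Lp ℝ 2 η} {h : E → ℝ} (hg : HasSum (fun n => c n • b n) g)
    (hh : ∀ x, HasSum (fun n => c n * φ n x) (h x)) : g =ᵐ[η] h := by
  obtain ⟨s, hs⟩ := Filter.exists_seq_tendsto (atTop : Filter (Finset ι))
  have h1 : Tendsto (fun j => ∑ n ∈ s j, c n • b n) atTop (𝓝 g) := hg.comp hs
  -- `L²` convergence gives almost everywhere convergence along a subsequence, which identifies the
  -- two sums.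
  obtain ⟨ns, hns, hlim⟩ := (tendstoInMeasure_of_tendsto_Lp h1).exists_seq_tendsto_ae
  have hpart : ∀ t : Finset ι, (∑ n ∈ t, c n • b n : Lp ℝ 2 η) =ᵐ[η] fun x => ∑ n ∈ t, c n * φ n x := by
    intro t
    classical
    induction t using Finset.induction_on with
    | empty => simpa using! Lp.coeFn_zero ℝ 2 η
    | insert a t ha ih =>
      rw [Finset.sum_insert ha]
      filter_upwards [Lp.coeFn_add (c a • b a) (∑ n ∈ t, c n • b n), Lp.coeFn_smul (c a) (b a),
        hb a, ih] with x h1 h2 h3 h4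
      rw [h1, Pi.add_apply, h2, Pi.smul_apply, h3, h4, Finset.sum_insert ha, smul_eq_mul]
  have hall : ∀ᵐ x ∂η, ∀ j, (∑ n ∈ s j, c n • b n : Lp ℝ 2 η) x = ∑ n ∈ s j, c n * φ n x :=
    ae_all_iff.2 fun j => hpart (s j)
  filter_upwards [hlim, hall] with x hx1 hx2
  simp only [hx2] at hx1
  exact tendsto_nhds_unique hx1 (((hh x).comp hs).comp hns.tendsto_atTop)

/-- The spectral expansion of an operator given by densities with given spectral coefficients. -/
lemma exists_hasSum_integral_density [Countable ι] (hb : ∀ n, b n =ᵐ[η] φ n)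
    {k : E → E → ℝ} (hk : ∀ x, MemLp (k x) 2 η) (hk0 : ∀ x, 0 ≤ᵐ[η] k x) {e : ι → ℝ}
    (he0 : ∀ n, 0 ≤ e n) (he1 : ∀ n, e n ≤ 1)
    (hc : ∀ x n, ∫ y, φ n y ∂η.withDensity (fun y => ENNReal.ofReal (k x y)) = e n * φ n x)
    {f : E → ℝ} (hf : MemLp f 2 η) :
    ∃ g : Lp ℝ 2 η,
      (g =ᵐ[η] fun x => ∫ y, f y ∂η.withDensity (fun y => ENNReal.ofReal (k x y))) ∧
      HasSum (fun n => (e n * ∫ y, φ n y * f y ∂η) • b n) g := by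
  set F := hf.toLp f
  have ha : ∀ n, b.repr F n = ∫ y, φ n y * f y ∂η := fun n => by
    rw [b.repr_apply_apply, Lp_inner_eq_integral (hb n) hf.coeFn_toLp]
  -- The factors lie in `[0, 1]`, so the damped coefficients stay square summable.
  have hmem : Memℓp (fun n => e n * ∫ y, φ n y * f y ∂η) 2 := by
    refine (memℓp_norm_iff.2 (lp.memℓp (b.repr F))).mono fun n => ?_
    rw [ha, norm_mul, Real.norm_of_nonneg (he0 n)]
    exact mul_le_of_le_one_left (norm_nonneg _) (he1 n)
  have hg := b.hasSum_repr_symm ⟨_, hmem⟩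
  refine ⟨_, ae_eq_of_hasSum_of_hasSum hb hg fun x => ?_, hg⟩
  -- Pairing the expansion of the density at `x` with `f` gives the series at every point `x`; it
  -- remains to match it with the `L²` sum.
  have h1 := (hasSum_density hb (hk x) (hk0 x) (hc x)).mapL (innerSL ℝ F)
  rw [innerSL_apply_apply, Lp_inner_eq_integral hf.coeFn_toLp (hk x).coeFn_toLp] at h1
  rw [integral_withDensity_ofReal (hk x).aestronglyMeasurable.aemeasurable (hk0 x)]
  convert! h1 using 1
  · ext n
    rw [innerSL_apply_apply, inner_smul_right, real_inner_comm,
      Lp_inner_eq_integral (hb n) hf.coeFn_toLp]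
    ring
  · simp_rw [mul_comm]

end SpectralKernel

end HDiffusion

namespace HDiffusion

/-! ### Gaussian laws in linear coordinates. -/

section GaussianCoordinates

open scoped RealInnerProductSpace

variable {r : ℕ}

/-- The linear coordinates `ξ ↦ G ξ` on the state space. -/
noncomputable def coords (G : Matrix (Fin r) (Fin r) ℝ) (hG : IsUnit G) : (Fin r → ℝ) ≃ᵐ State r where
  toFun ξ := act G (WithLp.toLp 2 ξ)
  invFun y := WithLp.ofLp (act G⁻¹ y)
  left_inv ξ := by
    simp [act, mulVec_mulVec, Matrix.nonsing_inv_mul _ ((Matrix.isUnit_iff_isUnit_det G).1 hG)]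
  right_inv y := by
    simp [act, mulVec_mulVec, Matrix.mul_nonsing_inv _ ((Matrix.isUnit_iff_isUnit_det G).1 hG)]
  measurable_toFun := by
    have : Measurable fun y : State r => act G y :=
      (toEuclideanCLM (𝕜 := ℝ) G).continuous.measurable
    exact this.comp (by fun_prop)
  measurable_invFun := by
    have : Measurable fun y : State r => act G⁻¹ y :=
      (toEuclideanCLM (𝕜 := ℝ) G⁻¹).continuous.measurable
    exact (by fun_prop : Measurable fun y : State r => WithLp.ofLp y).comp this

lemma coords_apply (G : Matrix (Fin r) (Fin r) ℝ) (hG : IsUnit G) (ξ : Fin r → ℝ) :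
    coords G hG ξ = act G (WithLp.toLp 2 ξ) := rfl

lemma map_coords_pi_gaussianReal {G : Matrix (Fin r) (Fin r) ℝ} (hG : IsUnit G) (m : Fin r → ℝ)
    (v : Fin r → ℝ≥0) :
    (Measure.pi fun i => gaussianReal (m i) (v i)).map (coords G hG)
      = multivariateGaussian (act G (WithLp.toLp 2 m)) (G * diagonal (fun i => (v i : ℝ)) * Gᵀ) := by
  have : IsProbabilityMeasure ((Measure.pi fun i => gaussianReal (m i) (v i)).map (coords G hG)) :=
    Measure.isProbabilityMeasure_map (coords G hG).measurable.aemeasurable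
  refine Measure.ext_of_charFun (funext fun u => ?_)
  rw [charFun_multivariateGaussian (posSemidef_conj_diagonal G fun i => (v i).coe_nonneg),
    charFun_apply, integral_map (coords G hG).measurable.aemeasurable
      (Measurable.aestronglyMeasurable (by fun_prop))]
  set w : Fin r → ℝ := Gᵀ *ᵥ WithLp.ofLp u with hw
  have hinner : ∀ ξ : Fin r → ℝ, ⟪act G (WithLp.toLp 2 ξ), u⟫ = ∑ i, ξ i * w i := by
    intro ξ
    have : ⟪act G (WithLp.toLp 2 ξ), u⟫ = (G *ᵥ ξ) ⬝ᵥ WithLp.ofLp u := by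
      simp [act, PiLp.inner_apply, dotProduct, mul_comm]
    rw [this, dotProduct_comm, dotProduct_mulVec, ← mulVec_transpose, dotProduct_comm]
    rfl
  have hquad : WithLp.ofLp u ⬝ᵥ (G * diagonal (fun i => (v i : ℝ)) * Gᵀ) *ᵥ WithLp.ofLp u
      = ∑ i, v i * w i ^ 2 := by
    rw [← mulVec_mulVec, ← mulVec_mulVec, dotProduct_mulVec, ← mulVec_transpose]
    simp only [← hw, dotProduct, mulVec_diagonal]
    exact Finset.sum_congr rfl fun i _ => by ring
  have hprod : ∀ ξ : Fin r → ℝ, Complex.exp (⟪coords G hG ξ, u⟫ * Complex.I)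
      = ∏ i, Complex.exp ((w i : ℂ) * ξ i * Complex.I) := by
    intro ξ
    rw [coords_apply, hinner, ← Complex.exp_sum, Complex.ofReal_sum, Finset.sum_mul]
    push_cast
    simp_rw [mul_comm]
  simp_rw [hprod]
  rw [integral_fintype_prod_eq_prod (fun i (s : ℝ) => Complex.exp ((w i : ℂ) * s * Complex.I))]
  simp_rw [← charFun_apply_real, charFun_gaussianReal]
  rw [← Complex.exp_sum, hquad, real_inner_comm, hinner]
  congr 1
  push_cast
  rw [Finset.sum_mul, Finset.sum_div, ← Finset.sum_sub_distrib]
  exact Finset.sum_congr rfl fun i _ => by ring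

lemma map_withDensity_measurableEquiv {α β : Type*} [MeasurableSpace α] [MeasurableSpace β]
    {μ : Measure α} (T : α ≃ᵐ β) (f : α → ℝ≥0∞) :
    (μ.withDensity f).map T = (μ.map T).withDensity fun y => f (T.symm y) := by
  ext s hs
  rw [Measure.map_apply T.measurable hs, withDensity_apply _ (T.measurable hs),
    withDensity_apply _ hs, T.restrict_map, lintegral_map_equiv]
  simp

end GaussianCoordinates

/-! ### Spectral decomposition of the kernels. -/

section Spectral

variable {r : ℕ} {A R S Z : Matrix (Fin r) (Fin r) ℝ} {lam : Fin r → ℝ}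

lemma eigval_nonneg (h : ∀ i, 0 < lam i) (n : Fin r → ℕ) : 0 ≤ eigval lam n :=
  Finset.sum_nonneg fun i _ => mul_nonneg (Nat.cast_nonneg _) (h i).le

lemma exp_neg_eigval_mul (lam : Fin r → ℝ) (n : Fin r → ℕ) (t : ℝ) :
    Real.exp (-(eigval lam n * t)) = ∏ i, Real.exp (-(lam i * t)) ^ n i := by
  simp_rw [← Real.exp_nat_mul]
  rw [← Real.exp_sum, eigval, Finset.sum_mul, ← Finset.sum_neg_distrib]
  congr 1
  exact Finset.sum_congr rfl fun i _ => by ring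

lemma phi_eq_hermiteProd {G : Matrix (Fin r) (Fin r) ℝ} (hG : IsUnit G)
    (hZG : Zᵀ * (CFC.sqrt (hCovInf A R S))⁻¹ = G⁻¹) (n : Fin r → ℕ) (x : State r) :
    phi A R S Z n x
      = hermiteProd n ((coords G hG).symm x) / √(∏ i, ((n i).factorial : ℝ)) := by
  rw [phi, hZG, hermiteMulti, hermiteProd]
  simp only [aeval_hermite_eq]
  rfl

lemma etaInf_eq_map {G : Matrix (Fin r) (Fin r) ℝ} (hG : IsUnit G)
    (hC : hCovInf A R S = G * Gᵀ) : etaInf A R S = (stdPi (Fin r)).map (coords G hG) := by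
  have h := map_coords_pi_gaussianReal hG 0 (fun _ => 1)
  rw [etaInf, hC]
  simp only [Pi.zero_apply, NNReal.coe_one, diagonal_one, Matrix.mul_one] at h
  rw [stdPi, h]
  congr 1
  ext i
  simp [act]

/-- The variances of the coordinates of the `h`-process at time `t`. -/
noncomputable def coordVar (lam : Fin r → ℝ) (t : ℝ≥0) (i : Fin r) : ℝ≥0 :=
  (1 - Real.exp (-(lam i * t)) ^ 2).toNNReal

lemma exp_neg_mul_sq_le_one (h : ∀ i, 0 < lam i) (t : ℝ≥0) (i : Fin r) :
    Real.exp (-(lam i * t)) ^ 2 ≤ 1 :=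
  pow_le_one₀ (Real.exp_pos _).le
    (Real.exp_le_one_iff.2 (neg_nonpos.2 (mul_nonneg (h i).le t.coe_nonneg)))

lemma coe_coordVar (h : ∀ i, 0 < lam i) (t : ℝ≥0) (i : Fin r) :
    (coordVar lam t i : ℝ) = 1 - Real.exp (-(lam i * t)) ^ 2 :=
  Real.coe_toNNReal _ (sub_nonneg.2 (exp_neg_mul_sq_le_one h t i))

lemma coordVar_ne_zero (h : ∀ i, 0 < lam i) {t : ℝ≥0} (ht : 0 < t) (i : Fin r) :
    coordVar lam t i ≠ 0 := by
  rw [coordVar, Ne, Real.toNNReal_eq_zero, not_le, sub_pos]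
  refine pow_lt_one₀ (Real.exp_pos _).le (Real.exp_lt_one_iff.2 ?_) two_ne_zero
  exact neg_neg_of_pos (mul_pos (h i) ht)

lemma coordVar_lt_two (lam : Fin r → ℝ) (t : ℝ≥0) (i : Fin r) : coordVar lam t i < 2 := by
  refine (Real.toNNReal_le_one.2 ?_).trans_lt one_lt_two
  exact sub_le_self _ (sq_nonneg _)

/-- Mean and covariance are diagonalized by the same `G`, so the problem splits into one-dimensional
kernels with correlation `ρ_i = e^{-λ_i t}` and variance `1 - ρ_i²`, the setting of Mehler's
formula. -/
lemma hKernel_eq_map {G : Matrix (Fin r) (Fin r) ℝ} (hG : IsUnit G) (hlam : ∀ i, 0 < lam i)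
    (hexp : ∀ t : ℝ, NormedSpace.exp (t • drift A R S)
      = G * diagonal (fun i => Real.exp (-(lam i * t))) * G⁻¹)
    (hcov : ∀ t : ℝ≥0, hCov A R S t
      = G * diagonal (fun i => 1 - Real.exp (-(lam i * t)) ^ 2) * Gᵀ) (t : ℝ≥0) (x : State r) :
    hKernel A R S t x = (Measure.pi fun i => gaussianReal
      (Real.exp (-(lam i * t)) * (coords G hG).symm x i) (coordVar lam t i)).map (coords G hG) := by
  rw [map_coords_pi_gaussianReal]
  change multivariateGaussian _ _ = _
  simp_rw [coe_coordVar hlam]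
  rw [hcov, hexp]
  congr 1
  simp only [act, ← mulVec_mulVec]
  congr 2
  ext i
  rw [mulVec_diagonal]
  rfl

lemma memLp_phi {G : Matrix (Fin r) (Fin r) ℝ} (hG : IsUnit G)
    (hZG : Zᵀ * (CFC.sqrt (hCovInf A R S))⁻¹ = G⁻¹) (hC : hCovInf A R S = G * Gᵀ)
    (n : Fin r → ℕ) : MemLp (phi A R S Z n) 2 (etaInf A R S) := by
  rw [etaInf_eq_map hG hC, (coords G hG).measurableEmbedding.memLp_map_measure_iff]
  have : phi A R S Z n ∘ coords G hG
      = fun ξ => (√(∏ i, ((n i).factorial : ℝ)))⁻¹ * hermiteProd n ξ := by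
    ext ξ
    rw [Function.comp_apply, phi_eq_hermiteProd hG hZG, MeasurableEquiv.symm_apply_apply,
      div_eq_inv_mul]
  rw [this]
  exact (memLp_hermiteProd n).const_mul _

lemma exists_hilbertBasis_phi {G : Matrix (Fin r) (Fin r) ℝ} (hG : IsUnit G)
    (hZG : Zᵀ * (CFC.sqrt (hCovInf A R S))⁻¹ = G⁻¹) (hC : hCovInf A R S = G * Gᵀ) :
    ∃ b : HilbertBasis (Fin r → ℕ) ℝ (Lp ℝ 2 (etaInf A R S)),
      ∀ n, b n =ᵐ[etaInf A R S] phi A R S Z n := by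
  have hη := etaInf_eq_map hG hC
  have hpos : ∀ n : Fin r → ℕ, 0 < ∏ i, ((n i).factorial : ℝ) := fun n =>
    Finset.prod_pos fun i _ => by exact_mod_cast (n i).factorial_pos
  refine exists_hilbertBasis_of_complete (memLp_phi hG hZG hC) (fun n m => ?_) fun g hg h => ?_
  · rw [hη, integral_map_equiv]
    simp_rw [phi_eq_hermiteProd hG hZG, MeasurableEquiv.symm_apply_apply, div_mul_div_comm]
    rw [integral_div, integral_hermiteProd_mul_hermiteProd]
    split_ifs with hnm
    · subst hnm
      rw [Real.mul_self_sqrt (hpos n).le, div_self (hpos n).ne']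
    · exact zero_div _
  · rw [hη] at hg ⊢
    rw [(coords G hG).measurableEmbedding.memLp_map_measure_iff] at hg
    have h0 := ae_eq_zero_of_integral_hermiteProd_eq_zero hg fun n => by
      have := h n
      rw [hη, integral_map_equiv] at this
      simp_rw [phi_eq_hermiteProd hG hZG, MeasurableEquiv.symm_apply_apply, div_mul_eq_mul_div] at this
      rw [integral_div, div_eq_zero_iff] at this
      exact this.resolve_right (Real.sqrt_pos.2 (hpos n)).ne'
    exact ((coords G hG).measurableEmbedding.ae_map_iff).2 h0

lemma integral_phi_hKernel {G : Matrix (Fin r) (Fin r) ℝ} (hG : IsUnit G)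
    (hZG : Zᵀ * (CFC.sqrt (hCovInf A R S))⁻¹ = G⁻¹) (hlam : ∀ i, 0 < lam i)
    (hexp : ∀ t : ℝ, NormedSpace.exp (t • drift A R S)
      = G * diagonal (fun i => Real.exp (-(lam i * t))) * G⁻¹)
    (hcov : ∀ t : ℝ≥0, hCov A R S t
      = G * diagonal (fun i => 1 - Real.exp (-(lam i * t)) ^ 2) * Gᵀ) (t : ℝ≥0) (n : Fin r → ℕ)
    (x : State r) :
    Integrable (phi A R S Z n) (hKernel A R S t x) ∧
      ∫ y, phi A R S Z n y ∂(hKernel A R S t x)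
        = Real.exp (-(eigval lam n * t)) * phi A R S Z n x := by
  rw [hKernel_eq_map hG hlam hexp hcov]
  constructor
  · rw [integrable_map_equiv]
    have : phi A R S Z n ∘ coords G hG
        = fun ξ => hermiteProd n ξ / √(∏ i, ((n i).factorial : ℝ)) := by
      ext ξ
      rw [Function.comp_apply, phi_eq_hermiteProd hG hZG, MeasurableEquiv.symm_apply_apply]
    rw [this]
    exact (integrable_hermiteProd n _ _).div_const _
  · rw [integral_map_equiv]
    simp_rw [phi_eq_hermiteProd hG hZG, MeasurableEquiv.symm_apply_apply]
    rw [integral_div, integral_hermiteProd n (fun i => Real.exp (-(lam i * t))) _ _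
      (coe_coordVar hlam t), ← exp_neg_eigval_mul, mul_div_assoc]

lemma exists_density_hKernel {G : Matrix (Fin r) (Fin r) ℝ} (hG : IsUnit G)
    (hC : hCovInf A R S = G * Gᵀ) (hlam : ∀ i, 0 < lam i)
    (hexp : ∀ t : ℝ, NormedSpace.exp (t • drift A R S)
      = G * diagonal (fun i => Real.exp (-(lam i * t))) * G⁻¹)
    (hcov : ∀ t : ℝ≥0, hCov A R S t
      = G * diagonal (fun i => 1 - Real.exp (-(lam i * t)) ^ 2) * Gᵀ) {t : ℝ≥0} (ht : 0 < t)
    (x : State r) :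
    ∃ k : State r → ℝ, MemLp k 2 (etaInf A R S) ∧ (∀ y, 0 ≤ k y) ∧
      hKernel A R S t x = (etaInf A R S).withDensity fun y => ENNReal.ofReal (k y) := by
  rw [hKernel_eq_map hG hlam hexp hcov, gaussianPi_eq_withDensity _ (coordVar_ne_zero hlam ht)
    (coordVar_lt_two lam t), map_withDensity_measurableEquiv, ← etaInf_eq_map hG hC]
  refine ⟨_, ?_, fun y => Finset.prod_nonneg fun i _ => gaussianRatio_nonneg _ _ _, rfl⟩
  rw [etaInf_eq_map hG hC, (coords G hG).measurableEmbedding.memLp_map_measure_iff]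
  simpa only [Function.comp_def, MeasurableEquiv.symm_apply_apply] using
    memLp_gaussianRatio_prod _ (coordVar_ne_zero hlam ht) (coordVar_lt_two lam t)

/-- At time 0 the density argument is unavailable, because the variances vanish. -/
lemma hKernel_zero {G : Matrix (Fin r) (Fin r) ℝ}
    (hcov : ∀ t : ℝ≥0, hCov A R S t
      = G * diagonal (fun i => 1 - Real.exp (-(lam i * t)) ^ 2) * Gᵀ) (x : State r) :
    hKernel A R S 0 x = Measure.dirac x := by
  have h0 : hCov A R S 0 = 0 := by
    rw [hcov]
    simp
  change multivariateGaussian _ _ = _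
  rw [h0, multivariateGaussian]
  simp [act, Measure.map_const]

/-- The spectral decomposition of the kernels of the `h`-process. -/
theorem spectral_decomposition (hR : R.PosDef) (hS : S.PosSemidef)
    (hAS : IsControllable Aᵀ (CFC.sqrt S)) (hrev : A * R = R * Aᵀ)
    (hZ : IsEigenData A R S Z lam) :
    ∃ b : HilbertBasis (Fin r → ℕ) ℝ (Lp ℝ 2 (etaInf A R S)),
      (∀ n, b n =ᵐ[etaInf A R S] phi A R S Z n) ∧
      ∀ t : ℝ≥0,
        (∀ n x, Integrable (phi A R S Z n) (hKernel A R S t x) ∧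
          ∫ y, phi A R S Z n y ∂(hKernel A R S t x)
            = Real.exp (-(eigval lam n * t)) * phi A R S Z n x) ∧
        (∀ f : State r → ℝ, MemLp f 2 (etaInf A R S) →
          (∀ᵐ x ∂(etaInf A R S), Integrable f (hKernel A R S t x)) ∧
          ∃ g : Lp ℝ 2 (etaInf A R S),
            (g =ᵐ[etaInf A R S] fun x => ∫ y, f y ∂(hKernel A R S t x)) ∧
            HasSum (fun n => (Real.exp (-(eigval lam n * t)) *
              ∫ y, phi A R S Z n y * f y ∂(etaInf A R S)) • b n) g) ∧
        (0 < t → ∀ x, ∃ k : Lp ℝ 2 (etaInf A R S), 0 ≤ᵐ[etaInf A R S] k ∧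
          hKernel A R S t x = (etaInf A R S).withDensity (fun y => ENNReal.ofReal (k y)) ∧
          HasSum (fun n => (Real.exp (-(eigval lam n * t)) * phi A R S Z n x) • b n) k) := by
  obtain ⟨hlam, -, G, hG, hZG, hC, hexp, hcov⟩ := eigenData_structure hR hS hAS hrev hZ
  obtain ⟨b, hb⟩ := exists_hilbertBasis_phi hG hZG hC
  have hphi := integral_phi_hKernel hG hZG hlam hexp hcov
  refine ⟨b, hb, fun t => ⟨hphi t, fun f hf => ?_, fun ht x => ?_⟩⟩
  -- For `t = 0` the claim is the expansion of `f` in the basis. For `t > 0` Cauchy-Schwarz gives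
  -- integrability at every `x`.
  · rcases eq_or_ne t 0 with rfl | ht
    · simp_rw [hKernel_zero hcov]
      refine ⟨ae_of_all _ fun x => integrable_dirac (by simp), hf.toLp f, ?_, ?_⟩
      · simp_rw [integral_dirac]
        exact hf.coeFn_toLp
      · simpa using hasSum_toLp_of_hilbertBasis hb hf
    · choose k hk hk0 hkK using exists_density_hKernel hG hC hlam hexp hcov (pos_iff_ne_zero.2 ht)
      simp_rw [hkK]
      refine ⟨ae_of_all _ fun x => integrable_withDensity_ofReal (hk x) (ae_of_all _ (hk0 x)) hf,
        exists_hasSum_integral_density hb hk (fun x => ae_of_all _ (hk0 x))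
          (fun n => (Real.exp_pos _).le) (fun n => ?_) (fun x n => ?_) hf⟩
      · exact Real.exp_le_one_iff.2
          (neg_nonpos.2 (mul_nonneg (eigval_nonneg hlam n) t.coe_nonneg))
      · rw [← hkK, (hphi t n x).2]
  · obtain ⟨k, hk, hk0, hkK⟩ := exists_density_hKernel hG hC hlam hexp hcov ht x
    refine ⟨hk.toLp k, ?_, ?_, hasSum_density hb hk (ae_of_all _ hk0) fun n => ?_⟩
    · filter_upwards [hk.coeFn_toLp] with y hy
      rw [hy]
      exact hk0 y
    · rw [hkK]
      refine withDensity_congr_ae ?_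
      filter_upwards [hk.coeFn_toLp] with y hy
      rw [hy]
    · rw [← hkK, (hphi t n x).2]

end Spectral

end HDiffusion


theorem mainTheorem6 {r : ℕ} (hr : 1 ≤ r) (A R S : Matrix (Fin r) (Fin r) ℝ)
    (hR : R.PosDef) (hS : S.PosSemidef)
    (hAR : HDiffusion.IsControllable A (CFC.sqrt R))
    (hAS : HDiffusion.IsControllable Aᵀ (CFC.sqrt S))
    (hrev : A * R = R * Aᵀ) :
    -- the objects of the statement are well defined
    (∃! Q, HDiffusion.IsRiccatiSolution A R S Q) ∧
    HDiffusion.HasPosEigenvalues (A ^ 2 + R * S) ∧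
    (∃! X, HDiffusion.IsPosSqrt (A ^ 2 + R * S) X) ∧
    (∀ i j, IntegrableOn
      (fun s => HDiffusion.gramIntegrand (HDiffusion.drift A R S) R s i j) (Set.Ioi 0)) ∧
    (HDiffusion.hCovInf A R S).PosDef ∧
    (∃ (Z : Matrix (Fin r) (Fin r) ℝ) (lam : Fin r → ℝ), HDiffusion.IsEigenData A R S Z lam) ∧
    -- the kernels are the transition probabilities of the `h`-process
    (∀ (Ω : Type*) [MeasurableSpace Ω] (P : Measure Ω) [IsProbabilityMeasure P] (d : ℕ)
      (B : Matrix (Fin r) (Fin d) ℝ) (W : Fin d → ℝ≥0 → Ω → ℝ) (X : ℝ≥0 → Ω → HDiffusion.State r)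
      (x : HDiffusion.State r),
      B * Bᵀ = R → HDiffusion.IsBrownianVector W P →
      HDiffusion.IsLinearDiffusion (HDiffusion.drift A R S) B x W X P →
      ∀ t, HasLaw (X t) (HDiffusion.hKernel A R S t x) P) ∧
    -- the spectral decomposition
    ∀ (Z : Matrix (Fin r) (Fin r) ℝ) (lam : Fin r → ℝ), HDiffusion.IsEigenData A R S Z lam →
      (∀ i, 0 < lam i) ∧
      Finset.univ.val.map lam = (A ^ 2 + R * S).charpoly.roots.map Real.sqrt ∧
      ∃ b : HilbertBasis (Fin r → ℕ) ℝ (Lp ℝ 2 (HDiffusion.etaInf A R S)),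
        (∀ n, b n =ᵐ[HDiffusion.etaInf A R S] HDiffusion.phi A R S Z n) ∧
        ∀ t : ℝ≥0,
          -- the functions `φ_n` are eigenfunctions, pointwise
          (∀ n x, Integrable (HDiffusion.phi A R S Z n) (HDiffusion.hKernel A R S t x) ∧
            ∫ y, HDiffusion.phi A R S Z n y ∂(HDiffusion.hKernel A R S t x)
              = Real.exp (-(HDiffusion.eigval lam n * t)) * HDiffusion.phi A R S Z n x) ∧
          -- the decomposition as an operator on `L₂`
          (∀ f : HDiffusion.State r → ℝ, MemLp f 2 (HDiffusion.etaInf A R S) →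
            (∀ᵐ x ∂(HDiffusion.etaInf A R S), Integrable f (HDiffusion.hKernel A R S t x)) ∧
            ∃ g : Lp ℝ 2 (HDiffusion.etaInf A R S),
              (g =ᵐ[HDiffusion.etaInf A R S] fun x => ∫ y, f y ∂(HDiffusion.hKernel A R S t x)) ∧
              HasSum (fun n => (Real.exp (-(HDiffusion.eigval lam n * t)) *
                ∫ y, HDiffusion.phi A R S Z n y * f y ∂(HDiffusion.etaInf A R S)) • b n) g) ∧
          -- for positive times, the decomposition of the kernel itself, at every point
          (0 < t → ∀ x, ∃ k : Lp ℝ 2 (HDiffusion.etaInf A R S),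
            0 ≤ᵐ[HDiffusion.etaInf A R S] k ∧
            HDiffusion.hKernel A R S t x
              = (HDiffusion.etaInf A R S).withDensity (fun y => ENNReal.ofReal (k y)) ∧
            HasSum (fun n => (Real.exp (-(HDiffusion.eigval lam n * t)) *
              HDiffusion.phi A R S Z n x) • b n) k) := by
  obtain ⟨hpos, hsqrt, -, -, hint, hP, -⟩ := HDiffusion.covariance_structure hR hS hAS hrev
  have hdata := HDiffusion.exists_isEigenData hR hS hAS hrev
  refine ⟨(HDiffusion.riccati_structure hR hS hAS hrev).1, hpos, hsqrt, hint, hP, hdata, ?_, ?_⟩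
  · intro Ω _ P _ d B W X x hB hW hX t
    -- Some eigenvector coordinates are chosen only to see that the covariance at time `t` is
    -- positive semidefinite.
    obtain ⟨Z, lam, hZ⟩ := hdata
    obtain ⟨hlam, -, G, -, -, -, -, hcov⟩ := HDiffusion.eigenData_structure hR hS hAS hrev hZ
    refine HDiffusion.hasLaw_linearDiffusion hB hW hX t (C := HDiffusion.hCov A R S t) rfl ?_
    rw [hcov]
    exact HDiffusion.posSemidef_conj_diagonal G fun i =>
      sub_nonneg.2 (HDiffusion.exp_neg_mul_sq_le_one hlam t i)
  · intro Z lam hZ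
    obtain ⟨hlam, hroots, -⟩ := HDiffusion.eigenData_structure hR hS hAS hrev hZ
    exact ⟨hlam, hroots, HDiffusion.spectral_decomposition hR hS hAS hrev hZ⟩
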